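/- Let $H_1=\mathbb R^3$ be the Heisenberg group with contact form $\Theta=dz+x\,dy-y\,dx$, contact planes $\xi=\ker\Theta$, orthonormal contact frame $\mathring e_1=\partial_x+y\partial_z$, $\mathring e_2=\partial_y-x\partial_z$, $T=\partial_z$, and $J\mathring e_1=\mathring e_2$, $J\mathring e_2=-\mathring e_1$; let $\nabla$ be the connection for which $\mathring e_1,\mathring e_2,T$ are parallel. Let $X:M\to H_1$ be a smoothly immersed surface ($M$ a smooth 2-manifold). A point is singular if the tangent plane there equals the contact plane, and regular otherwise. Near a regular point let $e_1$ be a smooth unit vector field in $TM\cap\xi$ and $e_2=Je_1$. The $p$-mean curvature $H$ is defined by $\nabla_{e_1}e_2=-He_1$; the surface is $p$-minimal if $H=0$ at all regular points. The function $\alpha$ is defined by the condition that $\alpha e_2+T$ is tangent to the surface. Compatible coordinates are smooth local coordinates $(x,y)$ on the regular part with $\partial_x=e_1$. An open part of a $p$-minimal surface is of type II (resp. type III) if around each of its points there are compatible coordinates in which $$\alpha=\frac{x+c_1(y)}{(x+c_1(y))^2+c_2(y)},\qquad c_2<0,$$ with either $x<-c_1(y)-\sqrt{-c_2(y)}$ throughout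 or $x>-c_1(y)+\sqrt{-c_2(y)}$ throughout (resp. with $-c_1(y)-\sqrt{-c_2(y)}<x<-c_1(y)+\sqrt{-c_2(y)}$). **Theorem.** Let $X:M\to H_1$ be a smoothly immersed $p$-minimal surface, let $\Gamma\subset M$ be a curve consisting of singular points, and let $S,S'\subset M$ be the two sides of $\Gamma$; that is, around each point of $\Gamma$ there are continuous local coordinates $(u,v)$ of $M$ in which $\Gamma=\{v=0\}$, $S=\{v>0\}$ and $S'=\{v<0\}$. (So $M$ extends the surface $S$ smoothly through its singular curve $\Gamma$.) 1. If $S$ is of type II, then $\Gamma$ has an open neighbourhood $V$ in $M$ such that $V\cap S'$ is of type III. 2. If $S$ is of type III, then $\Gamma$ has an open neighbourhood $V$ in $M$ such that $V\cap S'$ is of type II. -/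

import Mathlib

open scoped Manifold ContDiff

/-! The Heisenberg group `H₁`, surfaces in it, and the types of `p`-minimal surfaces. -/

namespace HeisenbergSurface

/-- The underlying manifold `ℝ³` of `H₁`, with coordinates `(x, y, z)`. -/
abbrev H1 : Type := ℝ × ℝ × ℝ

/-- The contact form `Θ = dz + x dy - y dx` at the point `P`. -/
def contactForm (P w : H1) : ℝ := w.2.2 + P.1 * w.2.1 - P.2.1 * w.1

/-- The contact vector `h₁ e₁° + h₂ e₂°` at `P`, where `e₁° = ∂_x + y ∂_z` and
`e₂° = ∂_y - x ∂_z` is the standard orthonormal frame of the contact bundle. -/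
def horizontal (P : H1) (h : ℝ × ℝ) : H1 := (h.1, h.2, h.1 * P.2.1 - h.2 * P.1)

/-- The vector field `T = ∂_z`. -/
def reeb : H1 := (0, 0, 1)

/-- The operator `J` (`J e₁° = e₂°`, `J e₂° = - e₁°`) on components in the frame
`e₁°, e₂°`. -/
def rot (h : ℝ × ℝ) : ℝ × ℝ := (-h.2, h.1)

/-- The components `h` describe a contact vector of length one. -/
def IsUnit₂ (h : ℝ × ℝ) : Prop := h.1 ^ 2 + h.2 ^ 2 = 1

section Surface

variable {M : Type*} [TopologicalSpace M] [ChartedSpace (ℝ × ℝ) M]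

/-- The tangent plane of the surface `X : M → H₁` at `q`, as a set of vectors of `ℝ³`. -/
def tangentPlane (X : M → H1) (q : M) : Set H1 :=
  Set.range fun v : TangentSpace 𝓘(ℝ, ℝ × ℝ) q =>
    (mfderiv 𝓘(ℝ, ℝ × ℝ) 𝓘(ℝ, H1) X q v : H1)

/-- `X : M → H₁` is a smoothly immersed surface. -/
structure IsImmersedSurface (X : M → H1) : Prop where
  smooth : ContMDiff 𝓘(ℝ, ℝ × ℝ) 𝓘(ℝ, H1) ∞ X
  injective_mfderiv : ∀ q : M, Function.Injective (mfderiv 𝓘(ℝ, ℝ × ℝ) 𝓘(ℝ, H1) X q)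

/-- `q` is a singular point: the tangent plane is the contact plane. -/
def IsSingularPoint (X : M → H1) (q : M) : Prop :=
  tangentPlane X q = {w : H1 | contactForm (X q) w = 0}

/-- On the open set `U` of regular points, `e₁ = h₁ e₁° + h₂ e₂°` is a smooth unit vector field
tangent to the surface and to the contact bundle. -/
structure IsCharacteristicField (X : M → H1) (U : Set M) (h : M → ℝ × ℝ) : Prop where
  isOpen : IsOpen U
  regular : ∀ q ∈ U, ¬ IsSingularPoint X q
  smooth : ContMDiffOn 𝓘(ℝ, ℝ × ℝ) 𝓘(ℝ, ℝ × ℝ) ∞ h U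
  unit : ∀ q ∈ U, IsUnit₂ (h q)
  tangent : ∀ q ∈ U, horizontal (X q) (h q) ∈ tangentPlane X q

/-- `∇_{e₁} e₂ = - H e₁` at `q`, where `e₁ = h₁ e₁° + h₂ e₂°` and `e₂ = J e₁`. As `e₁°` and `e₂°`
are parallel, `∇_{e₁}` differentiates components along the tangent vector `v` of `M` that
represents `e₁`. -/
def HasPMeanCurvatureAt (X : M → H1) (h : M → ℝ × ℝ) (q : M) (H : ℝ) : Prop :=
  ∀ v : TangentSpace 𝓘(ℝ, ℝ × ℝ) q,
    (mfderiv 𝓘(ℝ, ℝ × ℝ) 𝓘(ℝ, H1) X q v : H1) = horizontal (X q) (h q) →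
    (mfderiv 𝓘(ℝ, ℝ × ℝ) 𝓘(ℝ, ℝ × ℝ) (fun p => rot (h p)) q v : ℝ × ℝ) = -(H • h q)

/-- The surface is `p`-minimal: `H = 0` on the whole regular part. -/
def IsPMinimal (X : M → H1) : Prop :=
  ∀ (U : Set M) (h : M → ℝ × ℝ), IsCharacteristicField X U h →
    ∀ q ∈ U, HasPMeanCurvatureAt X h q 0

/-- `φ` is a compatible coordinate system `(x, y)`: a smooth chart such that
`e₁ = ∂/∂x` is a unit contact vector, with components `h` in the frame `e₁°, e₂°`. -/
structure IsCompatible (X : M → H1) (φ : OpenPartialHomeomorph M (ℝ × ℝ))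
    (h : ℝ × ℝ → ℝ × ℝ) : Prop where
  smooth_chart : φ ∈ IsManifold.maximalAtlas 𝓘(ℝ, ℝ × ℝ) ∞ M
  unit : ∀ p ∈ φ.target, IsUnit₂ (h p)
  partial_x : ∀ p ∈ φ.target,
    fderiv ℝ (X ∘ φ.symm) p (1, 0) = horizontal (X (φ.symm p)) (h p)

/-- `α` is the `α`-function in the compatible coordinates `φ`: `α e₂ + T` is tangent to the
surface, where `e₂ = J e₁`. (This makes all points of the chart regular and determines `α`.) -/
def IsAlphaFunction (X : M → H1) (φ : OpenPartialHomeomorph M (ℝ × ℝ))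
    (h : ℝ × ℝ → ℝ × ℝ) (α : ℝ × ℝ → ℝ) : Prop :=
  ∀ p ∈ φ.target,
    horizontal (X (φ.symm p)) (α p • rot (h p)) + reeb ∈ tangentPlane X (φ.symm p)

/-- In the compatible coordinates `φ`, the `α`-function is
`(x + c₁(y)) / ((x + c₁(y))² + c₂(y))`, with nowhere vanishing denominator. (Then `c₁` and `c₂`
are automatically smooth, as `(x + c₁)² + c₂ = 1 / (α_x + 2 α²)`.) -/
structure IsGeneralChart (X : M → H1) (φ : OpenPartialHomeomorph M (ℝ × ℝ))
    (c₁ c₂ : ℝ → ℝ) : Prop where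
  c₂_ne_zero : ∀ p ∈ φ.target, c₂ p.2 ≠ 0
  denom_ne_zero : ∀ p ∈ φ.target, (p.1 + c₁ p.2) ^ 2 + c₂ p.2 ≠ 0
  exists_compatible : ∃ h : ℝ × ℝ → ℝ × ℝ, IsCompatible X φ h ∧
    IsAlphaFunction X φ h fun p => (p.1 + c₁ p.2) / ((p.1 + c₁ p.2) ^ 2 + c₂ p.2)

/-- The part `S` of the surface is of type II: around each of its points there are compatible
coordinates with `α` of general type, `c₂ < 0`, and either `x < -c₁ - √(-c₂)` or
`x > -c₁ + √(-c₂)`. -/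
def IsTypeII (X : M → H1) (S : Set M) : Prop :=
  ∀ q ∈ S, ∃ (φ : OpenPartialHomeomorph M (ℝ × ℝ)) (c₁ c₂ : ℝ → ℝ),
    q ∈ φ.source ∧ φ.source ⊆ S ∧ IsGeneralChart X φ c₁ c₂ ∧
    (∀ p ∈ φ.target, c₂ p.2 < 0) ∧
    ((∀ p ∈ φ.target, p.1 < -c₁ p.2 - √(-c₂ p.2)) ∨
      (∀ p ∈ φ.target, -c₁ p.2 + √(-c₂ p.2) < p.1))

/-- The part `S` of the surface is of type III: around each of its points there are compatible
coordinates with `α` of general type, `c₂ < 0`, and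
`-c₁ - √(-c₂) < x < -c₁ + √(-c₂)`. -/
def IsTypeIII (X : M → H1) (S : Set M) : Prop :=
  ∀ q ∈ S, ∃ (φ : OpenPartialHomeomorph M (ℝ × ℝ)) (c₁ c₂ : ℝ → ℝ),
    q ∈ φ.source ∧ φ.source ⊆ S ∧ IsGeneralChart X φ c₁ c₂ ∧
    (∀ p ∈ φ.target, c₂ p.2 < 0) ∧
    (∀ p ∈ φ.target, -c₁ p.2 - √(-c₂ p.2) < p.1 ∧ p.1 < -c₁ p.2 + √(-c₂ p.2))

/-- `Γ` is a curve in the surface with `S` on one side and `S'` on the other: around each point of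
`Γ` there are (merely continuous) local coordinates of `M` in which `Γ`, `S`, `S'` are a
coordinate line and the two half-planes bounded by it. -/
def IsCurveWithSides (Γ S S' : Set M) : Prop :=
  ∀ q ∈ Γ, ∃ ψ : OpenPartialHomeomorph M (ℝ × ℝ), q ∈ ψ.source ∧
    ∀ p ∈ ψ.source,
      (p ∈ Γ ↔ (ψ p).2 = 0) ∧ (p ∈ S ↔ 0 < (ψ p).2) ∧ (p ∈ S' ↔ (ψ p).2 < 0)

end Surface

end HeisenbergSurface

/-! Near a singular point the tangent plane is close to the contact plane, so the surface is a graph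
`z = u` over the `xy`-plane, up to a rotation. The contact form pulls back to `k dx + g dy` with `k
= u_x - y` and `g = u_y + x`, and singular points are the common zeros of `k` and `g`. Where `g ≠ 0`
the characteristic direction is `(1, -σ)` with `σ = k / g`. `p`-minimality says that `σ` is constant
along this direction, so characteristic curves project to straight lines. Consequently `ω = σ_y`
(`spread`) satisfies the Riccati equation `ω' = ω²` along `(1, -σ)`, while `g' = 2 + ω g`.

The product `ω g` decides the type. In a chart of general type, with `w = x + c₁`, one has `(w² +
c₂) / w² = -ω g` (`IsGraphChart.invariant_eq`), so type II forces `ω g < 0` and type III forces `ω g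
> 0`. Conversely, arc length and slope along the characteristic lines are compatible coordinates
wherever `ω ≠ 0`, with `w = -√(1 + σ²) / ω` and `c₂ = w² (-1 - ω g)`; hence `-1 < ω g < 0` yields
type II and `ω g > 0` yields type III (`exists_typeII_chart`, `exists_typeIII_chart`).

It remains to follow `ω g` across `Γ`. The rotation is chosen so that `g_x > 0`; then `g` vanishes
on `Γ` and has opposite signs on the two sides (`IsSingularCurveAt.exists_sign`). The function `ω`,
a quotient with denominator `g²`, nevertheless has a common limit `Q` from both sides, because its
numerator vanishes to second order on `Γ` (`exists_tendsto_spread`). Moreover `Q ≠ 0`: otherwise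
uniqueness for the Riccati equation on the characteristic line ending at the singular point would
give `ω = 0` there, which neither type allows (`spread_limit_ne_zero`). So `ω` keeps its sign, `g`
changes sign, and `ω g` changes sign; since `ω g → 0`, the bound `-1 < ω g` holds near `Γ`. -/

namespace HeisenbergSurface

section

open Filter Topology Set

/-! ### Partial derivatives in the plane -/

/-- The first partial derivative. -/
noncomputable def dx (f : ℝ × ℝ → ℝ) (p : ℝ × ℝ) : ℝ := fderiv ℝ f p (1, 0)

/-- The second partial derivative. -/
noncomputable def dy (f : ℝ × ℝ → ℝ) (p : ℝ × ℝ) : ℝ := fderiv ℝ f p (0, 1)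

theorem fderiv_apply_eq (f : ℝ × ℝ → ℝ) (p v : ℝ × ℝ) :
    fderiv ℝ f p v = v.1 * dx f p + v.2 * dy f p := by
  have : v = v.1 • ((1 : ℝ), (0 : ℝ)) + v.2 • ((0 : ℝ), (1 : ℝ)) := by ext <;> simp
  conv_lhs => rw [this]
  rw [map_add, map_smul, map_smul]
  simp [dx, dy]

theorem contDiffAt_dx {f : ℝ × ℝ → ℝ} {p : ℝ × ℝ} (hf : ContDiffAt ℝ ∞ f p) :
    ContDiffAt ℝ ∞ (dx f) p :=
  (hf.fderiv_right (m := ∞) (by simp)).clm_apply contDiffAt_const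

theorem contDiffAt_dy {f : ℝ × ℝ → ℝ} {p : ℝ × ℝ} (hf : ContDiffAt ℝ ∞ f p) :
    ContDiffAt ℝ ∞ (dy f) p :=
  (hf.fderiv_right (m := ∞) (by simp)).clm_apply contDiffAt_const

theorem _root_.ContDiffAt.diff {f : ℝ × ℝ → ℝ} {p : ℝ × ℝ} (hf : ContDiffAt ℝ ∞ f p) :
    DifferentiableAt ℝ f p := hf.differentiableAt (by simp)

theorem dx_congr {f g : ℝ × ℝ → ℝ} {p : ℝ × ℝ} (h : f =ᶠ[𝓝 p] g) : dx f p = dx g p := by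
  simp [dx, h.fderiv_eq]

theorem dy_congr {f g : ℝ × ℝ → ℝ} {p : ℝ × ℝ} (h : f =ᶠ[𝓝 p] g) : dy f p = dy g p := by
  simp [dy, h.fderiv_eq]

section Rules

variable {f g : ℝ × ℝ → ℝ} {p : ℝ × ℝ}

theorem dx_mul (hf : DifferentiableAt ℝ f p) (hg : DifferentiableAt ℝ g p) :
    dx (fun q => f q * g q) p = dx f p * g p + f p * dx g p := by
  simp only [dx]
  rw [fderiv_fun_mul hf hg]
  simp; ring

theorem dy_mul (hf : DifferentiableAt ℝ f p) (hg : DifferentiableAt ℝ g p) :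
    dy (fun q => f q * g q) p = dy f p * g p + f p * dy g p := by
  simp only [dy]
  rw [fderiv_fun_mul hf hg]
  simp; ring

theorem dx_sub (hf : DifferentiableAt ℝ f p) (hg : DifferentiableAt ℝ g p) :
    dx (fun q => f q - g q) p = dx f p - dx g p := by
  simp only [dx]
  rw [fderiv_fun_sub hf hg]
  simp

theorem dx_add (hf : DifferentiableAt ℝ f p) (hg : DifferentiableAt ℝ g p) :
    dx (fun q => f q + g q) p = dx f p + dx g p := by
  simp only [dx]
  rw [fderiv_fun_add hf hg]
  simp

theorem dy_sub (hf : DifferentiableAt ℝ f p) (hg : DifferentiableAt ℝ g p) :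
    dy (fun q => f q - g q) p = dy f p - dy g p := by
  simp only [dy]
  rw [fderiv_fun_sub hf hg]
  simp

theorem fderiv_div_apply (hf : DifferentiableAt ℝ f p) (hg : DifferentiableAt ℝ g p)
    (h0 : g p ≠ 0) (v : ℝ × ℝ) :
    fderiv ℝ (fun q => f q / g q) p v
      = (fderiv ℝ f p v * g p - f p * fderiv ℝ g p v) / g p ^ 2 := by
  have hd : DifferentiableAt ℝ (fun q => f q / g q) p := by
    simpa only [div_eq_mul_inv] using hf.fun_mul (hg.fun_inv h0)
  have h := fderiv_fun_mul hd hg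
  have he : (fun q => f q / g q * g q) =ᶠ[𝓝 p] f := by
    filter_upwards [hg.continuousAt.eventually_ne h0] with q hq
    field_simp
  rw [he.fderiv_eq] at h
  rw [h]
  simp
  field_simp
  ring

/-- Mixed partial derivatives agree. -/
theorem dx_dy_comm (hf : ContDiffAt ℝ ∞ f p) : dx (dy f) p = dy (dx f) p := by
  have hs := hf.isSymmSndFDerivAt (n := ∞) 
    (by simpa using (show ((2 : ℕ∞) : WithTop ℕ∞) ≤ ((⊤ : ℕ∞) : WithTop ℕ∞) from
      WithTop.coe_le_coe.2 le_top))
  have hd : DifferentiableAt ℝ (fderiv ℝ f) p :=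
    (hf.fderiv_right (m := ∞) (by simp)).differentiableAt (by simp)
  have key : ∀ v w : ℝ × ℝ, fderiv ℝ (fun q => fderiv ℝ f q v) p w = fderiv ℝ (fderiv ℝ f) p w v := by
    intro v w
    rw [fderiv_clm_apply hd (differentiableAt_const v)]
    simp
  unfold dx dy
  rw [key, key]
  exact hs _ _

end Rules

theorem hasDerivAt_comp_line {f : ℝ × ℝ → ℝ} {p v : ℝ × ℝ} {s : ℝ}
    (hf : DifferentiableAt ℝ f (p + s • v)) :
    HasDerivAt (fun t : ℝ => f (p + t • v)) (fderiv ℝ f (p + s • v) v) s := by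
  have h1 : HasDerivAt (fun t : ℝ => p + t • v) v s := by
    simpa using ((hasDerivAt_id s).smul_const v).const_add p
  exact hf.hasFDerivAt.comp_hasDerivAt s h1

theorem hasDerivAt_comp_horizontal {f : ℝ × ℝ → ℝ} {x y : ℝ}
    (hf : DifferentiableAt ℝ f (x, y)) : HasDerivAt (fun t : ℝ => f (t, y)) (dx f (x, y)) x := by
  have h1 : HasDerivAt (fun t : ℝ => (t, y)) ((1 : ℝ), (0 : ℝ)) x :=
    (hasDerivAt_id x).prodMk (hasDerivAt_const x y)
  exact hf.hasFDerivAt.comp_hasDerivAt x h1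

/-! ### The contact form on a p-minimal graph -/

/-- `k dx + g dy` is the pull back of the contact form to the parameter domain `Ω` of a
`p`-minimal graph: `d(k dx + g dy) = 2 dx ∧ dy`, and where `g ≠ 0` the slope `k / g` is constant
along the characteristic direction `(g, -k)`. -/
structure IsPMinimalForm (Ω : Set (ℝ × ℝ)) (k g : ℝ × ℝ → ℝ) : Prop where
  isOpen : IsOpen Ω
  smooth_k : ∀ p ∈ Ω, ContDiffAt ℝ ∞ k p
  smooth_g : ∀ p ∈ Ω, ContDiffAt ℝ ∞ g p
  curl : ∀ p ∈ Ω, dx g p - dy k p = 2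
  minimal : ∀ p ∈ Ω, g p ≠ 0 →
    g p * (dx k p * g p - k p * dx g p) = k p * (dy k p * g p - k p * dy g p)

/-- The negative of the slope of the characteristic lines. -/
noncomputable def slope (k g : ℝ × ℝ → ℝ) (p : ℝ × ℝ) : ℝ := k p / g p

/-- The numerator of `spread`. -/
noncomputable def wronskian (k g : ℝ × ℝ → ℝ) (p : ℝ × ℝ) : ℝ :=
  dy k p * g p - k p * dy g p

/-- The `y`-derivative of the slope. -/
noncomputable def spread (k g : ℝ × ℝ → ℝ) (p : ℝ × ℝ) : ℝ := wronskian k g p / g p ^ 2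

theorem contDiffAt_wronskian {k g : ℝ × ℝ → ℝ} {p : ℝ × ℝ} (hk : ContDiffAt ℝ ∞ k p)
    (hg : ContDiffAt ℝ ∞ g p) : ContDiffAt ℝ ∞ (wronskian k g) p :=
  ((contDiffAt_dy hk).mul hg).sub (hk.mul (contDiffAt_dy hg))

namespace IsPMinimalForm

variable {Ω : Set (ℝ × ℝ)} {k g : ℝ × ℝ → ℝ} {p : ℝ × ℝ}

theorem eventually_mem (H : IsPMinimalForm Ω k g) (hp : p ∈ Ω) (h0 : g p ≠ 0) :
    ∀ᶠ q in 𝓝 p, q ∈ Ω ∧ g q ≠ 0 :=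
  (show ∀ᶠ q in 𝓝 p, q ∈ Ω from H.isOpen.mem_nhds hp).and ((H.smooth_g p hp).continuousAt.eventually_ne h0)

theorem contDiffAt_slope (H : IsPMinimalForm Ω k g) (hp : p ∈ Ω) (h0 : g p ≠ 0) :
    ContDiffAt ℝ ∞ (slope k g) p :=
  (H.smooth_k p hp).div (H.smooth_g p hp) h0

theorem contDiffAt_spread (H : IsPMinimalForm Ω k g) (hp : p ∈ Ω) (h0 : g p ≠ 0) :
    ContDiffAt ℝ ∞ (spread k g) p :=
  (contDiffAt_wronskian (H.smooth_k p hp) (H.smooth_g p hp)).div ((H.smooth_g p hp).pow 2)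
    (pow_ne_zero 2 h0)

theorem dy_slope (H : IsPMinimalForm Ω k g) (hp : p ∈ Ω) (h0 : g p ≠ 0) :
    dy (slope k g) p = spread k g p :=
  fderiv_div_apply (H.smooth_k p hp).diff (H.smooth_g p hp).diff h0 _

/-- Minimality divided by a power of `g`: the slope satisfies the inviscid Burgers equation `σ_x = σ
σ_y`. -/
theorem dx_slope (H : IsPMinimalForm Ω k g) (hp : p ∈ Ω) (h0 : g p ≠ 0) :
    dx (slope k g) p = slope k g p * spread k g p := by
  have h1 : dx (slope k g) p = (dx k p * g p - k p * dx g p) / g p ^ 2 :=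
    fderiv_div_apply (H.smooth_k p hp).diff (H.smooth_g p hp).diff h0 _
  have h2 := H.minimal p hp h0
  rw [h1, slope, spread, wronskian, div_mul_div_comm, div_eq_div_iff (by positivity) (by positivity)]
  linear_combination g p ^ 2 * h2

/-- The `y`-derivative of the Burgers equation for `σ`, with the mixed derivatives interchanged. -/
theorem riccati (H : IsPMinimalForm Ω k g) (hp : p ∈ Ω) (h0 : g p ≠ 0) :
    dx (spread k g) p - slope k g p * dy (spread k g) p = spread k g p ^ 2 := by
  have hev := H.eventually_mem hp h0
  have e1 : dy (slope k g) =ᶠ[𝓝 p] spread k g := by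
    filter_upwards [hev] with q hq using H.dy_slope hq.1 hq.2
  have e2 : dx (slope k g) =ᶠ[𝓝 p] fun q => slope k g q * spread k g q := by
    filter_upwards [hev] with q hq using H.dx_slope hq.1 hq.2
  have h := dx_dy_comm (H.contDiffAt_slope hp h0)
  rw [dx_congr e1, dy_congr e2, dy_mul (H.contDiffAt_slope hp h0).diff
    (H.contDiffAt_spread hp h0).diff, H.dy_slope hp h0] at h
  linear_combination h

/-- Since `ω g = k_y - σ g_y`, this is only the curl condition `g_x = k_y + 2`. -/
theorem deriv_g (H : IsPMinimalForm Ω k g) (hp : p ∈ Ω) (h0 : g p ≠ 0) :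
    dx g p - slope k g p * dy g p = 2 + spread k g p * g p := by
  have := H.curl p hp
  rw [slope, spread, wronskian]
  field_simp
  linear_combination g p * this

end IsPMinimalForm

/-! ### One-variable tools -/

/-- A solution of a linear differential equation with bounded coefficient that tends to zero at
the left end of an interval vanishes. -/
theorem eq_zero_of_hasDerivAt_mul_self {f c : ℝ → ℝ} {a C : ℝ}
    (hf : ∀ s ∈ Ioo 0 a, HasDerivAt f (c s * f s) s) (hc : ∀ s ∈ Ioo 0 a, |c s| ≤ C)
    (h0 : Tendsto f (𝓝[>] 0) (𝓝 0)) : ∀ s ∈ Ioo 0 a, f s = 0 := by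
  intro s hs
  -- Grönwall weight: the exponential makes the nonnegative function `h` decreasing, and its limit
  -- at the left end is zero.
  set h : ℝ → ℝ := fun t => f t ^ 2 * Real.exp (-(2 * C) * t) with hh
  have hd : ∀ t ∈ Ioo 0 a, HasDerivAt h (2 * (c t - C) * h t) t := by
    intro t ht
    have e : HasDerivAt (fun t => Real.exp (-(2 * C) * t))
        (Real.exp (-(2 * C) * t) * (-(2 * C))) t := by
      simpa using ((hasDerivAt_id t).const_mul (-(2 * C))).exp
    have := ((hf t ht).fun_pow 2).fun_mul e
    refine this.congr_deriv ?_
    simp [hh]; ring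
  have hanti : AntitoneOn h (Ioo 0 a) := by
    apply antitoneOn_of_deriv_nonpos (convex_Ioo 0 a)
      (fun t ht => (hd t ht).continuousAt.continuousWithinAt)
    · rw [interior_Ioo]
      exact fun t ht => (hd t ht).differentiableAt.differentiableWithinAt
    · rw [interior_Ioo]
      intro t ht
      rw [(hd t ht).deriv]
      have h1 : c t - C ≤ 0 := by linarith [(abs_le.1 (hc t ht)).2]
      have h2 : 0 ≤ h t := by simp only [hh]; positivity
      nlinarith
  have hlim : Tendsto h (𝓝[>] 0) (𝓝 0) := by
    have e : Tendsto (fun t => Real.exp (-(2 * C) * t)) (𝓝[>] 0) (𝓝 (Real.exp (-(2 * C) * 0))) :=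
      tendsto_nhdsWithin_of_tendsto_nhds (Continuous.tendsto (by fun_prop) 0)
    have := (h0.pow 2).mul e
    rwa [show (0 : ℝ) ^ 2 * Real.exp (-(2 * C) * 0) = 0 by simp] at this
  have hle : h s ≤ 0 := by
    refine ge_of_tendsto hlim ?_
    filter_upwards [Ioo_mem_nhdsGT hs.1] with t ht
    exact hanti ⟨ht.1, ht.2.trans hs.2⟩ hs ht.2.le
  have hz : f s ^ 2 ≤ 0 := by
    by_contra hcon
    have : 0 < h s := mul_pos (not_le.1 hcon) (Real.exp_pos _)
    linarith
  exact pow_eq_zero_iff (two_ne_zero) |>.1 (le_antisymm hz (sq_nonneg _))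

/-- Cauchy's mean value theorem on a horizontal segment one of whose ends is a common zero. -/
theorem exists_ratio_dx {A B : ℝ × ℝ → ℝ} {x₀ r x ξ y : ℝ}
    (hA : ∀ t, |t - x₀| < r → DifferentiableAt ℝ A (t, y))
    (hB : ∀ t, |t - x₀| < r → DifferentiableAt ℝ B (t, y))
    (hx : |x - x₀| < r) (hξ : |ξ - x₀| < r) (hne : x ≠ ξ)
    (hA0 : A (ξ, y) = 0) (hB0 : B (ξ, y) = 0) :
    ∃ η, η ≠ ξ ∧ |η - x₀| < r ∧ B (x, y) * dx A (η, y) = A (x, y) * dx B (η, y) := by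
  rw [abs_lt] at hx hξ
  have hd : ∀ t ∈ uIcc x ξ, |t - x₀| < r := by
    intro t ht
    rw [mem_uIcc] at ht
    rw [abs_lt]
    constructor <;> rcases ht with ht | ht <;> linarith
  have cA : ContinuousOn (fun t => A (t, y)) (uIcc x ξ) := fun t ht =>
    (hasDerivAt_comp_horizontal (hA t (hd t ht))).continuousAt.continuousWithinAt
  have cB : ContinuousOn (fun t => B (t, y)) (uIcc x ξ) := fun t ht =>
    (hasDerivAt_comp_horizontal (hB t (hd t ht))).continuousAt.continuousWithinAt
  rcases lt_or_gt_of_ne hne with h | h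
  · rw [uIcc_of_le h.le] at hd cA cB
    obtain ⟨η, hη, he⟩ := exists_ratio_hasDerivAt_eq_ratio_slope _ _ h cA
      (fun t ht => hasDerivAt_comp_horizontal (hA t (hd t (Ioo_subset_Icc_self ht)))) _ _ cB
      (fun t ht => hasDerivAt_comp_horizontal (hB t (hd t (Ioo_subset_Icc_self ht))))
    refine ⟨η, hη.2.ne, hd η (Ioo_subset_Icc_self hη), ?_⟩
    simp only [hA0, hB0] at he
    linear_combination -he
  · rw [uIcc_of_ge h.le] at hd cA cB
    obtain ⟨η, hη, he⟩ := exists_ratio_hasDerivAt_eq_ratio_slope _ _ h cA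
      (fun t ht => hasDerivAt_comp_horizontal (hA t (hd t (Ioo_subset_Icc_self ht)))) _ _ cB
      (fun t ht => hasDerivAt_comp_horizontal (hB t (hd t (Ioo_subset_Icc_self ht))))
    refine ⟨η, hη.1.ne', hd η (Ioo_subset_Icc_self hη), ?_⟩
    simp only [hA0, hB0] at he
    linear_combination he

theorem mem_ball_prod {p q : ℝ × ℝ} {r : ℝ} :
    q ∈ Metric.ball p r ↔ |q.1 - p.1| < r ∧ |q.2 - p.2| < r := by
  rw [Metric.mem_ball, Prod.dist_eq, max_lt_iff, Real.dist_eq, Real.dist_eq]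

/-! ### Limits at a singular curve -/

/-- `Z` is a set of degenerate common zeros of `k` and `g` that meets all horizontal lines
near `p₀`, and `g` increases in the direction of these lines. -/
structure IsSingularCurveAt (Z : Set (ℝ × ℝ)) (k g : ℝ × ℝ → ℝ) (p₀ : ℝ × ℝ) : Prop where
  mem : p₀ ∈ Z
  k_eq_zero : ∀ p ∈ Z, k p = 0
  g_eq_zero : ∀ p ∈ Z, g p = 0
  det_eq_zero : ∀ p ∈ Z, dx k p * dy g p = dy k p * dx g p
  dx_pos : 0 < dx g p₀
  slices : ∀ a > 0, ∀ᶠ q in 𝓝 p₀, ∃ ξ, |ξ - p₀.1| < a ∧ (ξ, q.2) ∈ Z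

/-- Turns the output of Cauchy's mean value theorem into a limit: `f` takes near `p₀` only values
that the continuous `R` takes near `p₀`. -/
theorem tendsto_of_forall_exists_ball {f R g : ℝ × ℝ → ℝ} {p₀ : ℝ × ℝ} (hR : ContinuousAt R p₀)
    (h : ∀ᶠ r in 𝓝[>] (0 : ℝ), ∀ᶠ q in 𝓝 p₀, g q ≠ 0 → ∃ η ∈ Metric.ball p₀ r, f q = R η) :
    Tendsto f (𝓝[{q | g q ≠ 0}] p₀) (𝓝 (R p₀)) := by
  rw [Metric.tendsto_nhds]
  intro ε hε
  obtain ⟨δ, hδ, hb⟩ := Metric.continuousAt_iff.1 hR ε hε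
  obtain ⟨r, hr, hrδ⟩ := (h.and (Ioo_mem_nhdsGT hδ)).exists
  rw [eventually_nhdsWithin_iff]
  filter_upwards [hr] with q hq hgq
  obtain ⟨η, hη, he⟩ := hq hgq
  rw [he]
  exact hb (lt_trans (Metric.mem_ball.1 hη) hrδ.2)

theorem eventually_forall_ball {P : ℝ × ℝ → Prop} {p : ℝ × ℝ} (h : ∀ᶠ q in 𝓝 p, P q) :
    ∀ᶠ r in 𝓝[>] (0 : ℝ), ∀ q ∈ Metric.ball p r, P q := by
  obtain ⟨δ, hδ, hb⟩ := Metric.eventually_nhds_iff_ball.1 h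
  filter_upwards [Ioo_mem_nhdsGT hδ] with r hr q hq
  exact hb q (Metric.ball_subset_ball hr.2.le hq)

theorem lt_of_dx_pos_on_slice {g : ℝ × ℝ → ℝ} {p₀ : ℝ × ℝ} {r x ξ y : ℝ}
    (hr : ∀ q ∈ Metric.ball p₀ r, ContDiffAt ℝ ∞ g q ∧ 0 < dx g q)
    (hx : |x - p₀.1| < r) (hξ : |ξ - p₀.1| < r) (hy : |y - p₀.2| < r) (hlt : x < ξ) :
    g (x, y) < g (ξ, y) := by
  have hm : ∀ t, |t - p₀.1| < r → (t, y) ∈ Metric.ball p₀ r := fun t ht =>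
    mem_ball_prod.2 ⟨ht, hy⟩
  have hd : ∀ t ∈ Icc x ξ, |t - p₀.1| < r := by
    intro t ht
    rw [abs_lt] at hx hξ ⊢
    constructor <;> linarith [ht.1, ht.2]
  have : StrictMonoOn (fun t => g (t, y)) (Icc x ξ) := by
    apply strictMonoOn_of_deriv_pos (convex_Icc x ξ)
    · exact fun t ht => (hasDerivAt_comp_horizontal
        (hr _ (hm t (hd t ht))).1.diff).continuousAt.continuousWithinAt
    · intro t ht
      rw [interior_Icc] at ht
      have := hr _ (hm t (hd t (Ioo_subset_Icc_self ht)))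
      rw [(hasDerivAt_comp_horizontal this.1.diff).deriv]
      exact this.2
  exact this (left_mem_Icc.2 hlt.le) (right_mem_Icc.2 hlt.le) hlt

theorem tendsto_ray (p v : ℝ × ℝ) : Tendsto (fun s : ℝ => p + s • v) (𝓝[>] 0) (𝓝 p) := by
  have : ContinuousAt (fun s : ℝ => p + s • v) 0 := by fun_prop
  simpa using this.tendsto.mono_left nhdsWithin_le_nhds

namespace IsPMinimalForm

variable {Ω Z : Set (ℝ × ℝ)} {k g : ℝ × ℝ → ℝ} {p₀ : ℝ × ℝ}

/-- L'Hôpital's rule along horizontal lines: each line near `p₀` carries a common zero of `k` and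
`g`, so `k / g` equals `k_x / g_x` at an intermediate point. Working line by line makes the limit
uniform in both variables. -/
theorem tendsto_slope (H : IsPMinimalForm Ω k g) (hp : p₀ ∈ Ω) (hZ : IsSingularCurveAt Z k g p₀) :
    Tendsto (slope k g) (𝓝[{q | g q ≠ 0}] p₀) (𝓝 (dx k p₀ / dx g p₀)) := by
  have ck := contDiffAt_dx (H.smooth_k _ hp)
  have cg := contDiffAt_dx (H.smooth_g _ hp)
  apply tendsto_of_forall_exists_ball (R := fun q => dx k q / dx g q)
    (ck.continuousAt.div cg.continuousAt hZ.dx_pos.ne')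
  have ev : ∀ᶠ q in 𝓝 p₀, q ∈ Ω ∧ 0 < dx g q :=
    (show ∀ᶠ q in 𝓝 p₀, q ∈ Ω from H.isOpen.mem_nhds hp).and
      (cg.continuousAt.eventually_const_lt hZ.dx_pos)
  filter_upwards [eventually_forall_ball ev, self_mem_nhdsWithin] with r hr hr0
  filter_upwards [hZ.slices r hr0, Metric.ball_mem_nhds p₀ hr0] with q ⟨ξ, hξ, hξZ⟩ hq hgq
  obtain ⟨x, y⟩ := q
  obtain ⟨hx, hy⟩ := mem_ball_prod.1 hq
  have hm : ∀ t, |t - p₀.1| < r → (t, y) ∈ Metric.ball p₀ r := fun t ht =>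
    mem_ball_prod.2 ⟨ht, hy⟩
  have hne : x ≠ ξ := by
    rintro rfl
    exact hgq (hZ.g_eq_zero _ hξZ)
  obtain ⟨η, -, hη, he⟩ := exists_ratio_dx (A := k) (B := g)
    (fun t ht => (H.smooth_k _ (hr _ (hm t ht)).1).diff)
    (fun t ht => (H.smooth_g _ (hr _ (hm t ht)).1).diff) hx hξ hne
    (hZ.k_eq_zero _ hξZ) (hZ.g_eq_zero _ hξZ)
  refine ⟨(η, y), hm η hη, ?_⟩
  have := (hr _ (hm η hη)).2.ne'
  simp only [slope]
  rw [div_eq_div_iff hgq this]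
  linear_combination -he

/-- L'Hôpital's rule applied twice to `wronskian / g²` on horizontal lines. The numerator vanishes
on `Z` because `k` and `g` do, and so does its `x`-derivative `k_y g_x - k_x g_y`, by degeneracy.
The second derivative of `g²` is `2 g_x² > 0` at `p₀`, so the quotient of second derivatives is
continuous there, and the limit is the same from both sides. -/
theorem exists_tendsto_spread (H : IsPMinimalForm Ω k g) (hp : p₀ ∈ Ω)
    (hZ : IsSingularCurveAt Z k g p₀) :
    ∃ Q, Tendsto (spread k g) (𝓝[{q | g q ≠ 0}] p₀) (𝓝 Q) := by
  have ckk := H.smooth_k _ hp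
  have cgg := H.smooth_g _ hp
  have ck := contDiffAt_dx ckk
  have cg := contDiffAt_dx cgg
  have cg2 := contDiffAt_dx cg
  have cW := contDiffAt_dx (contDiffAt_dx (contDiffAt_wronskian ckk cgg))
  have hg0 := hZ.g_eq_zero _ hZ.mem
  have hB : ContinuousAt (fun q => 2 * (dx g q * dx g q + g q * dx (dx g) q)) p₀ :=
    (((cg.mul cg).add (cgg.mul cg2)).continuousAt).const_mul 2
  have hBpos : 0 < 2 * (dx g p₀ * dx g p₀ + g p₀ * dx (dx g) p₀) := by
    rw [hg0, zero_mul, add_zero]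
    have := hZ.dx_pos
    positivity
  refine ⟨_, tendsto_of_forall_exists_ball
    (R := fun q => dx (dx (wronskian k g)) q / (2 * (dx g q * dx g q + g q * dx (dx g) q)))
    (cW.continuousAt.div hB hBpos.ne') ?_⟩
  have ev : ∀ᶠ q in 𝓝 p₀, q ∈ Ω ∧ 0 < dx g q ∧
      0 < 2 * (dx g q * dx g q + g q * dx (dx g) q) :=
    (show ∀ᶠ q in 𝓝 p₀, q ∈ Ω from H.isOpen.mem_nhds hp).and
      ((cg.continuousAt.eventually_const_lt hZ.dx_pos).and (hB.eventually_const_lt hBpos))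
  filter_upwards [eventually_forall_ball ev, self_mem_nhdsWithin] with r hr hr0
  filter_upwards [hZ.slices r hr0, Metric.ball_mem_nhds p₀ hr0] with q ⟨ξ, hξ, hξZ⟩ hq hgq
  obtain ⟨x, y⟩ := q
  obtain ⟨hx, hy⟩ := mem_ball_prod.1 hq
  have hm : ∀ t, |t - p₀.1| < r → (t, y) ∈ Metric.ball p₀ r := fun t ht =>
    mem_ball_prod.2 ⟨ht, hy⟩
  have sk : ∀ t, |t - p₀.1| < r → ContDiffAt ℝ ∞ k (t, y) := fun t ht =>
    H.smooth_k _ (hr _ (hm t ht)).1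
  have sg : ∀ t, |t - p₀.1| < r → ContDiffAt ℝ ∞ g (t, y) := fun t ht =>
    H.smooth_g _ (hr _ (hm t ht)).1
  have sW : ∀ t, |t - p₀.1| < r → ContDiffAt ℝ ∞ (wronskian k g) (t, y) := fun t ht =>
    contDiffAt_wronskian (sk t ht) (sg t ht)
  have zk := hZ.k_eq_zero _ hξZ
  have zg := hZ.g_eq_zero _ hξZ
  have zd := hZ.det_eq_zero _ hξZ
  have hne : x ≠ ξ := by
    rintro rfl
    exact hgq zg
  obtain ⟨η, hηξ, hη, he⟩ := exists_ratio_dx (A := wronskian k g) (B := fun q => g q * g q)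
    (fun t ht => (sW t ht).diff) (fun t ht => ((sg t ht).mul (sg t ht)).diff) hx hξ hne
    (by simp [wronskian, zk, zg]) (by simp [zg])
  -- The first quotient has denominator `2 g g_x` at `η`, which has to be cancelled; `g` vanishes
  -- only once on the line because it is strictly increasing there.
  have hgη : g (η, y) ≠ 0 := by
    have hr' : ∀ q ∈ Metric.ball p₀ r, ContDiffAt ℝ ∞ g q ∧ 0 < dx g q := fun q hq =>
      ⟨H.smooth_g _ (hr q hq).1, (hr q hq).2.1⟩
    rcases lt_or_gt_of_ne hηξ with h | h
    · have := lt_of_dx_pos_on_slice hr' hη hξ hy h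
      rw [zg] at this
      exact this.ne
    · have := lt_of_dx_pos_on_slice hr' hξ hη hy h
      rw [zg] at this
      exact this.ne'
  have dW0 : dx (wronskian k g) (ξ, y) = 0 := by
    have a1 := (sk ξ hξ).diff
    have a2 := (sg ξ hξ).diff
    have a3 := (contDiffAt_dy (sk ξ hξ)).diff
    have a4 := (contDiffAt_dy (sg ξ hξ)).diff
    have := dx_sub (a3.fun_mul a2) (a1.fun_mul a4)
    rw [dx_mul a3 a2, dx_mul a1 a4, zk, zg] at this
    refine this.trans ?_
    linear_combination -zd
  obtain ⟨η', -, hη', he'⟩ := exists_ratio_dx (A := dx (wronskian k g))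
    (B := fun q => 2 * (g q * dx g q))
    (fun t ht => (contDiffAt_dx (sW t ht)).diff)
    (fun t ht => (((sg t ht).mul (contDiffAt_dx (sg t ht))).diff).const_mul 2) hη hξ hηξ
    dW0 (by simp [zg])
  refine ⟨(η', y), hm η' hη', ?_⟩
  have hD := (hr _ (hm η' hη')).2.2.ne'
  have hgx := (hr _ (hm η hη)).2.1.ne'
  have e1 : dx (fun q => g q * g q) (η, y) = 2 * (g (η, y) * dx g (η, y)) := by
    rw [dx_mul (sg η hη).diff (sg η hη).diff]; ring
  have e2 : dx (fun q => 2 * (g q * dx g q)) (η', y)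
      = 2 * (dx g (η', y) * dx g (η', y) + g (η', y) * dx (dx g) (η', y)) := by
    have b1 := (sg η' hη').diff
    have b2 := (contDiffAt_dx (sg η' hη')).diff
    rw [dx_mul (f := fun _ => (2 : ℝ)) (differentiableAt_const 2) (b1.fun_mul b2), dx_mul b1 b2]
    simp [dx]
  rw [e1] at he
  rw [e2] at he'
  simp only [spread]
  have hne2 : 2 * (g (η, y) * dx g (η, y)) ≠ 0 := by positivity
  rw [div_eq_div_iff (pow_ne_zero 2 hgq) hD]
  apply mul_left_cancel₀ hne2
  linear_combination (-(g (x, y)) ^ 2) * he' - (2 * (dx g (η', y) * dx g (η', y) + g (η', y) * dx (dx g) (η', y))) * he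

/-- On one side of the singular curve lies a ray of the line with the limit slope. -/
theorem eventually_pos_ray (H : IsPMinimalForm Ω k g) (hp : p₀ ∈ Ω)
    (hZ : IsSingularCurveAt Z k g p₀) {ε : ℝ} (hε : ε ^ 2 = 1) :
    ∀ᶠ s in 𝓝[>] (0 : ℝ), 0 < ε * g (p₀ + s • (ε, -(ε * (dx k p₀ / dx g p₀)))) := by
  set σ₀ := dx k p₀ / dx g p₀ with hσ₀
  set v : ℝ × ℝ := (ε, -(ε * σ₀)) with hv
  have hg0 := hZ.g_eq_zero _ hZ.mem
  -- Degeneracy gives `σ₀ g_y = k_y` at `p₀`, so `g_x - σ₀ g_y = g_x - k_y = 2`: the limiting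
  -- characteristic line crosses the curve transversally.
  have hG : HasDerivAt (fun s : ℝ => g (p₀ + s • v)) (2 * ε) 0 := by
    have := hasDerivAt_comp_line (f := g) (p := p₀) (v := v) (s := 0)
      (by simpa using (H.smooth_g _ hp).diff)
    refine this.congr_deriv ?_
    have hx := hZ.dx_pos.ne'
    have hσy : σ₀ * dy g p₀ = dy k p₀ := by
      rw [hσ₀]; field_simp; linear_combination hZ.det_eq_zero _ hZ.mem
    rw [fderiv_apply_eq]
    simp only [zero_smul, add_zero, hv]
    linear_combination ε * (H.curl _ hp) - ε * hσy
  have h1 := (hasDerivAt_iff_tendsto_slope_zero.1 hG).mono_left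
    (nhdsWithin_mono 0 (fun s (hs : 0 < s) => hs.ne'))
  have h2 := (h1.const_mul ε).eventually_const_lt (show 0 < ε * (2 * ε) by nlinarith)
  filter_upwards [h2, self_mem_nhdsWithin] with s hs hs0
  simp only [zero_add, zero_smul, add_zero, hg0, sub_zero, smul_eq_mul] at hs
  have hs0' : (0 : ℝ) < s := hs0
  have : ε * g (p₀ + s • v) = s * (ε * (s⁻¹ * g (p₀ + s • v))) := by field_simp
  rw [this]
  exact mul_pos hs0' hs

/-- The limit of `spread` at a singular curve is nonzero if `spread` is nonzero on one side:
along the characteristic line through the limit point `spread` solves a Riccati equation. -/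
theorem spread_limit_ne_zero (H : IsPMinimalForm Ω k g) (hp : p₀ ∈ Ω)
    (hZ : IsSingularCurveAt Z k g p₀) {ε : ℝ} (hε : ε ^ 2 = 1)
    (hS : ∀ᶠ q in 𝓝 p₀, 0 < ε * g q → spread k g q ≠ 0) {Q : ℝ}
    (hQ : Tendsto (spread k g) (𝓝[{q | g q ≠ 0}] p₀) (𝓝 Q)) : Q ≠ 0 := by
  rintro rfl
  set σ₀ := dx k p₀ / dx g p₀
  set v : ℝ × ℝ := (ε, -(ε * σ₀)) with hv
  have hline : Tendsto (fun s : ℝ => p₀ + s • v) (𝓝[>] 0) (𝓝 p₀) := tendsto_ray p₀ v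
  have hpos : ∀ᶠ s in 𝓝[>] (0 : ℝ), 0 < ε * g (p₀ + s • v) := H.eventually_pos_ray hp hZ hε
  have hlim : Tendsto (fun s : ℝ => p₀ + s • v) (𝓝[>] 0) (𝓝[{q | g q ≠ 0}] p₀) := by
    rw [tendsto_nhdsWithin_iff]
    refine ⟨hline, hpos.mono fun s hs => ?_⟩
    rintro h0
    rw [h0] at hs
    simp at hs
  have hbd : ∀ᶠ s in 𝓝[>] (0 : ℝ), |spread k g (p₀ + s • v)| < 1 := by
    have := (hQ.comp hlim).abs
    rw [abs_zero] at this
    exact this.eventually_lt_const one_pos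
  have hall := hpos.and (hbd.and ((hline.eventually hS).and
    (hline.eventually (show ∀ᶠ q in 𝓝 p₀, q ∈ Ω from H.isOpen.mem_nhds hp))))
  obtain ⟨a, ha, hsub⟩ := mem_nhdsGT_iff_exists_Ioo_subset.1 hall
  have ha' : (0 : ℝ) < a := ha
  have hgne : ∀ s ∈ Ioo 0 a, g (p₀ + s • v) ≠ 0 := by
    intro s hs h0
    have := (hsub hs).1
    rw [h0] at this
    simp at this
  have habsε : |ε| = 1 := by
    rcases mul_eq_zero.1 (show (ε - 1) * (ε + 1) = 0 by linear_combination hε) with h | h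
    · simp [sub_eq_zero.1 h]
    · simp [eq_neg_of_add_eq_zero_left h]
  have hcoef : ∀ s ∈ Ioo 0 a, |ε * spread k g (p₀ + s • v)| ≤ 1 := by
    intro s hs
    rw [abs_mul, habsε, one_mul]
    exact (hsub hs).2.1.le
  -- The ray is not known in advance to be characteristic. On it `σ - σ₀` solves a linear equation
  -- with coefficient `ε ω`, bounded because `ω` has a limit, and it tends to zero at `p₀`; hence `σ
  -- = σ₀` on the ray.
  have hslope : ∀ s ∈ Ioo 0 a, slope k g (p₀ + s • v) - σ₀ = 0 := by
    refine eq_zero_of_hasDerivAt_mul_self (c := fun s => ε * spread k g (p₀ + s • v)) (C := 1)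
      ?_ hcoef ?_
    · intro s hs
      have hΩ := (hsub hs).2.2.2
      have := (hasDerivAt_comp_line (H.contDiffAt_slope hΩ (hgne s hs)).diff).sub_const σ₀
      refine this.congr_deriv ?_
      rw [fderiv_apply_eq, H.dx_slope hΩ (hgne s hs), H.dy_slope hΩ (hgne s hs)]
      simp only [hv]
      ring
    · have := ((H.tendsto_slope hp hZ).comp hlim).sub_const σ₀
      rwa [sub_self] at this
  -- Now that the ray is characteristic, the Riccati equation holds on it; read as `ω' = (ε ω) ω`,
  -- it is a linear equation with bounded coefficient.
  have hspread : ∀ s ∈ Ioo 0 a, spread k g (p₀ + s • v) = 0 := by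
    refine eq_zero_of_hasDerivAt_mul_self (c := fun s => ε * spread k g (p₀ + s • v)) (C := 1)
      ?_ hcoef (hQ.comp hlim)
    intro s hs
    have hΩ := (hsub hs).2.2.2
    refine (hasDerivAt_comp_line (H.contDiffAt_spread hΩ (hgne s hs)).diff).congr_deriv ?_
    have h1 := H.riccati hΩ (hgne s hs)
    have h2 : slope k g (p₀ + s • v) = σ₀ := sub_eq_zero.1 (hslope s hs)
    rw [h2] at h1
    rw [fderiv_apply_eq]
    simp only [hv] at h1 ⊢
    linear_combination ε * h1
  have hmid : a / 2 ∈ Ioo 0 a := ⟨by positivity, by linarith⟩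
  exact (hsub hmid).2.2.1 (hsub hmid).1 (hspread _ hmid)

end IsPMinimalForm

/-! ### Charts of the surface -/

section Charts

variable {M : Type*} [TopologicalSpace M] [ChartedSpace (ℝ × ℝ) M]
  {φ φ' : OpenPartialHomeomorph M (ℝ × ℝ)}
  {F : Type*} [NormedAddCommGroup F] [NormedSpace ℝ F]

/-- A local diffeomorphism of the plane turns a chart into a chart. -/
theorem exists_chart_comp [IsManifold 𝓘(ℝ, ℝ × ℝ) ∞ M]
    (hφ : φ ∈ IsManifold.maximalAtlas 𝓘(ℝ, ℝ × ℝ) ∞ M)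
    {f : ℝ × ℝ → ℝ × ℝ} {q : M} (hq : q ∈ φ.source)
    (hf : ∀ᶠ p in 𝓝 (φ q), ContDiffAt ℝ ∞ f p)
    (hinj : Function.Injective (fderiv ℝ f (φ q))) :
    ∃ φ' ∈ IsManifold.maximalAtlas 𝓘(ℝ, ℝ × ℝ) ∞ M, q ∈ φ'.source ∧ φ'.source ⊆ φ.source ∧
      ∀ x ∈ φ'.source, φ' x = f (φ x) := by
  set L : (ℝ × ℝ) ≃L[ℝ] (ℝ × ℝ) :=
    (LinearEquiv.ofInjectiveEndo (fderiv ℝ f (φ q)).toLinearMap hinj).toContinuousLinearEquiv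
    with hL
  have hLe : (L : (ℝ × ℝ) →L[ℝ] (ℝ × ℝ)) = fderiv ℝ f (φ q) := by
    ext <;> rfl
  have hfq := hf.self_of_nhds
  have hcont : ContinuousAt (fderiv ℝ f) (φ q) :=
    (hfq.fderiv_right (m := ∞) (by simp)).continuousAt
  -- Invertibility of the derivative is needed on a neighbourhood, so that the local inverse is
  -- smooth on its whole domain and not only at one point.
  have hev : ∀ᶠ p in 𝓝 (φ q), ContDiffAt ℝ ∞ f p ∧
      fderiv ℝ f p ∈ range ((↑) : ((ℝ × ℝ) ≃L[ℝ] (ℝ × ℝ)) → (ℝ × ℝ) →L[ℝ] (ℝ × ℝ)) :=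
    hf.and (hcont.eventually_mem (hLe ▸ ContinuousLinearEquiv.nhds L))
  obtain ⟨U, hU, hUo, hqU⟩ := eventually_nhds_iff.1 hev
  have hder : HasFDerivAt f (L : (ℝ × ℝ) →L[ℝ] (ℝ × ℝ)) (φ q) := by
    rw [hLe]; exact (hfq.differentiableAt (by simp)).hasFDerivAt
  set e := (hfq.toOpenPartialHomeomorph f hder (by simp)).restrOpen U hUo with he
  have hsrc : ∀ x ∈ e.source, x ∈ U := fun x hx => by
    simp only [he, OpenPartialHomeomorph.restrOpen_source] at hx
    exact hx.2
  have hqe : φ q ∈ e.source := by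
    simp only [he, OpenPartialHomeomorph.restrOpen_source]
    exact ⟨hfq.mem_toOpenPartialHomeomorph_source hder (by simp), hqU⟩
  have hsymm : ∀ y ∈ e.target, ContDiffAt ℝ ∞ e.symm y := by
    intro y hy
    obtain ⟨hd, L', hL'⟩ := hU _ (hsrc _ (e.map_target hy))
    refine e.contDiffAt_symm (f₀' := L') hy ?_ hd
    rw [hL']
    exact (hd.differentiableAt (by simp)).hasFDerivAt
  refine ⟨φ.trans e, ?_, ?_, ?_, ?_⟩
  · apply OpenPartialHomeomorph.mem_maximalAtlas_of_contMDiffOn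
    · intro x hx
      rw [OpenPartialHomeomorph.trans_source] at hx
      have h1 : ContMDiffAt 𝓘(ℝ, ℝ × ℝ) 𝓘(ℝ, ℝ × ℝ) ∞ e (φ x) :=
        (hU _ (hsrc _ hx.2)).1.contMDiffAt
      exact (h1.comp x (contMDiffAt_of_mem_maximalAtlas hφ hx.1)).contMDiffWithinAt
    · intro y hy
      rw [OpenPartialHomeomorph.trans_target] at hy
      have h1 : ContMDiffAt 𝓘(ℝ, ℝ × ℝ) 𝓘(ℝ, ℝ × ℝ) ∞ e.symm y := (hsymm y hy.1).contMDiffAt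
      exact ((contMDiffAt_symm_of_mem_maximalAtlas hφ hy.2).comp y h1).contMDiffWithinAt
  · rw [OpenPartialHomeomorph.trans_source]
    exact ⟨hq, hqe⟩
  · rw [OpenPartialHomeomorph.trans_source]
    exact inter_subset_left
  · intro x _
    rfl

theorem restr_mem_maximalAtlas_of_isOpen (hφ : φ ∈ IsManifold.maximalAtlas 𝓘(ℝ, ℝ × ℝ) ∞ M) {s : Set M}
    (hs : IsOpen s) : φ.restr s ∈ IsManifold.maximalAtlas 𝓘(ℝ, ℝ × ℝ) ∞ M :=
  restr_mem_maximalAtlas (contDiffGroupoid ∞ 𝓘(ℝ, ℝ × ℝ)) hφ hs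

theorem contDiffAt_comp_symm (hφ : φ ∈ IsManifold.maximalAtlas 𝓘(ℝ, ℝ × ℝ) ∞ M) {f : M → F}
    {p : ℝ × ℝ} (hp : p ∈ φ.target)
    (hf : ContMDiffAt 𝓘(ℝ, ℝ × ℝ) 𝓘(ℝ, F) ∞ f (φ.symm p)) :
    ContDiffAt ℝ ∞ (f ∘ φ.symm) p :=
  (hf.comp p (contMDiffAt_symm_of_mem_maximalAtlas hφ hp)).contDiffAt

theorem contDiffAt_transition (hφ : φ ∈ IsManifold.maximalAtlas 𝓘(ℝ, ℝ × ℝ) ∞ M)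
    (hφ' : φ' ∈ IsManifold.maximalAtlas 𝓘(ℝ, ℝ × ℝ) ∞ M) {p : ℝ × ℝ} (hp : p ∈ φ.target)
    (hp' : φ.symm p ∈ φ'.source) : ContDiffAt ℝ ∞ (φ' ∘ φ.symm) p :=
  contDiffAt_comp_symm hφ hp (contMDiffAt_of_mem_maximalAtlas hφ' hp')

theorem fderiv_comp_symm (hφ : φ ∈ IsManifold.maximalAtlas 𝓘(ℝ, ℝ × ℝ) ∞ M) {f : M → F}
    {p : ℝ × ℝ} (hp : p ∈ φ.target)
    (hf : MDifferentiableAt 𝓘(ℝ, ℝ × ℝ) 𝓘(ℝ, F) f (φ.symm p)) (v : ℝ × ℝ) :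
    fderiv ℝ (f ∘ φ.symm) p v = mfderiv 𝓘(ℝ, ℝ × ℝ) 𝓘(ℝ, F) f (φ.symm p)
      (mfderiv 𝓘(ℝ, ℝ × ℝ) 𝓘(ℝ, ℝ × ℝ) φ.symm p v) := by
  have h1 : MDifferentiableAt 𝓘(ℝ, ℝ × ℝ) 𝓘(ℝ, ℝ × ℝ) φ.symm p :=
    (contMDiffAt_symm_of_mem_maximalAtlas hφ hp).mdifferentiableAt (by simp)
  rw [← mfderiv_eq_fderiv, mfderiv_comp p hf h1]
  rfl

theorem mfderiv_symm_surjective (hφ : φ ∈ IsManifold.maximalAtlas 𝓘(ℝ, ℝ × ℝ) ∞ M)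
    {p : ℝ × ℝ} (hp : p ∈ φ.target) :
    Function.Surjective (mfderiv 𝓘(ℝ, ℝ × ℝ) 𝓘(ℝ, ℝ × ℝ) φ.symm p) := by
  have h1 : MDifferentiableAt 𝓘(ℝ, ℝ × ℝ) 𝓘(ℝ, ℝ × ℝ) φ.symm p :=
    (contMDiffAt_symm_of_mem_maximalAtlas hφ hp).mdifferentiableAt (by simp)
  have h2 : MDifferentiableAt 𝓘(ℝ, ℝ × ℝ) 𝓘(ℝ, ℝ × ℝ) φ (φ.symm p) :=
    (contMDiffAt_of_mem_maximalAtlas hφ (φ.map_target hp)).mdifferentiableAt (by simp)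
  have h3 : mfderiv 𝓘(ℝ, ℝ × ℝ) 𝓘(ℝ, ℝ × ℝ) (φ.symm ∘ φ) (φ.symm p)
      = ContinuousLinearMap.id ℝ _ := by
    rw [← mfderiv_id]
    apply Filter.EventuallyEq.mfderiv_eq
    filter_upwards [φ.open_source.mem_nhds (φ.map_target hp)] with x hx
    exact φ.left_inv hx
  intro w
  have h1' : MDifferentiableAt 𝓘(ℝ, ℝ × ℝ) 𝓘(ℝ, ℝ × ℝ) φ.symm (φ (φ.symm p)) := by
    rwa [φ.right_inv hp]
  rw [mfderiv_comp (φ.symm p) h1' h2] at h3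
  have h4 := congrArg (fun L => L w) h3
  rw [φ.right_inv hp] at h4
  exact ⟨_, h4⟩

theorem tangentPlane_symm {X : M → H1} (hX : IsImmersedSurface X)
    (hφ : φ ∈ IsManifold.maximalAtlas 𝓘(ℝ, ℝ × ℝ) ∞ M) {p : ℝ × ℝ} (hp : p ∈ φ.target) :
    tangentPlane X (φ.symm p) = range (fderiv ℝ (X ∘ φ.symm) p) := by
  have hd : MDifferentiableAt 𝓘(ℝ, ℝ × ℝ) 𝓘(ℝ, H1) X (φ.symm p) :=
    (hX.smooth _).mdifferentiableAt (by simp)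
  ext w
  constructor
  · rintro ⟨v, rfl⟩
    obtain ⟨v', rfl⟩ := mfderiv_symm_surjective hφ hp v
    exact ⟨v', fderiv_comp_symm hφ hp hd v'⟩
  · rintro ⟨v, rfl⟩
    exact ⟨_, (fderiv_comp_symm hφ hp hd v).symm⟩

end Charts

/-! ### Graph charts -/

section Graph

variable {M : Type*} [TopologicalSpace M] [ChartedSpace (ℝ × ℝ) M]

/-- In the chart `φ` the surface is the graph of `u` over the contact plane at the origin, up to
the rotation with cosine `c` and sine `s`. -/
structure IsGraphChart (X : M → H1) (φ : OpenPartialHomeomorph M (ℝ × ℝ)) (c s : ℝ)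
    (u : ℝ × ℝ → ℝ) : Prop where
  smooth_chart : φ ∈ IsManifold.maximalAtlas 𝓘(ℝ, ℝ × ℝ) ∞ M
  unit : c ^ 2 + s ^ 2 = 1
  eq : ∀ p ∈ φ.target, X (φ.symm p) = (c * p.1 - s * p.2, s * p.1 + c * p.2, u p)

/-- The `dx`-component of the contact form on the graph of `u`. -/
noncomputable def formK (u : ℝ × ℝ → ℝ) (p : ℝ × ℝ) : ℝ := dx u p - p.2

/-- The `dy`-component of the contact form on the graph of `u`. -/
noncomputable def formG (u : ℝ × ℝ → ℝ) (p : ℝ × ℝ) : ℝ := dy u p + p.1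

theorem contactForm_horizontal (P : H1) (h : ℝ × ℝ) : contactForm P (horizontal P h) = 0 := by
  simp only [contactForm, horizontal]; ring

theorem contDiffAt_formK {u : ℝ × ℝ → ℝ} {p : ℝ × ℝ} (hu : ContDiffAt ℝ ∞ u p) :
    ContDiffAt ℝ ∞ (formK u) p := (contDiffAt_dx hu).sub contDiffAt_snd

theorem contDiffAt_formG {u : ℝ × ℝ → ℝ} {p : ℝ × ℝ} (hu : ContDiffAt ℝ ∞ u p) :
    ContDiffAt ℝ ∞ (formG u) p := (contDiffAt_dy hu).add contDiffAt_fst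

theorem dx_formG {u : ℝ × ℝ → ℝ} {p : ℝ × ℝ} (hu : ContDiffAt ℝ ∞ u p) :
    dx (formG u) p = dx (dy u) p + 1 := by
  have := dx_add (contDiffAt_dy hu).diff (differentiableAt_fst (𝕜 := ℝ) (p := p))
  refine this.trans ?_
  simp [dx, fderiv_fst]

theorem dy_formK {u : ℝ × ℝ → ℝ} {p : ℝ × ℝ} (hu : ContDiffAt ℝ ∞ u p) :
    dy (formK u) p = dy (dx u) p - 1 := by
  have := dy_sub (contDiffAt_dx hu).diff (differentiableAt_snd (𝕜 := ℝ) (p := p))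
  refine this.trans ?_
  simp [dy, fderiv_snd]

namespace IsGraphChart

variable {X : M → H1} {φ : OpenPartialHomeomorph M (ℝ × ℝ)} {c s : ℝ} {u : ℝ × ℝ → ℝ}
  {p : ℝ × ℝ}

theorem contDiffAt_u (hφ : IsGraphChart X φ c s u) (hX : IsImmersedSurface X)
    (hp : p ∈ φ.target) : ContDiffAt ℝ ∞ u p := by
  have h := (contDiffAt_comp_symm hφ.smooth_chart hp (hX.smooth _)).snd.snd
  refine h.congr_of_eventuallyEq ?_
  filter_upwards [φ.open_target.mem_nhds hp] with q hq
  simp [hφ.eq q hq]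

theorem fderiv_eq (hφ : IsGraphChart X φ c s u) (hX : IsImmersedSurface X) (hp : p ∈ φ.target)
    (v : ℝ × ℝ) : fderiv ℝ (X ∘ φ.symm) p v
      = (c * v.1 - s * v.2, s * v.1 + c * v.2, v.1 * dx u p + v.2 * dy u p) := by
  have he : X ∘ φ.symm =ᶠ[𝓝 p] fun q => (c * q.1 - s * q.2, s * q.1 + c * q.2, u q) := by
    filter_upwards [φ.open_target.mem_nhds hp] with q hq
    exact hφ.eq q hq
  have hfst : HasFDerivAt (fun q : ℝ × ℝ => q.1) (ContinuousLinearMap.fst ℝ ℝ ℝ) p := hasFDerivAt_fst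
  have hsnd : HasFDerivAt (fun q : ℝ × ℝ => q.2) (ContinuousLinearMap.snd ℝ ℝ ℝ) p := hasFDerivAt_snd
  have h1 := ((hfst.const_mul c).sub (hsnd.const_mul s)).prodMk
    (((hfst.const_mul s).add (hsnd.const_mul c)).prodMk
      (hφ.contDiffAt_u hX hp).diff.hasFDerivAt)
  rw [he.fderiv_eq]
  have h2 := h1.fderiv
  refine (congrArg (fun L => L v) h2).trans ?_
  simp [fderiv_apply_eq]

theorem contactForm_fderiv (hφ : IsGraphChart X φ c s u) (hX : IsImmersedSurface X)
    (hp : p ∈ φ.target) (v : ℝ × ℝ) :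
    contactForm (X (φ.symm p)) (fderiv ℝ (X ∘ φ.symm) p v)
      = v.1 * formK u p + v.2 * formG u p := by
  rw [hφ.fderiv_eq hX hp, hφ.eq p hp]
  simp only [contactForm, formK, formG]
  linear_combination (p.1 * v.2 - p.2 * v.1) * hφ.unit

theorem form_eq_zero (hφ : IsGraphChart X φ c s u) (hX : IsImmersedSurface X)
    (hp : p ∈ φ.target) (hs : IsSingularPoint X (φ.symm p)) : formK u p = 0 ∧ formG u p = 0 := by
  have key : ∀ v : ℝ × ℝ, v.1 * formK u p + v.2 * formG u p = 0 := by
    intro v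
    rw [← hφ.contactForm_fderiv hX hp]
    have : fderiv ℝ (X ∘ φ.symm) p v ∈ tangentPlane X (φ.symm p) := by
      rw [tangentPlane_symm hX hφ.smooth_chart hp]
      exact mem_range_self v
    rw [hs] at this
    exact this
  exact ⟨by simpa using key (1, 0), by simpa using key (0, 1)⟩

/-- The components of `e₁` in terms of the slope. -/
noncomputable def frame (c s : ℝ) (u : ℝ × ℝ → ℝ) (p : ℝ × ℝ) : ℝ × ℝ :=
  ((c + s * slope (formK u) (formG u) p) / √(1 + slope (formK u) (formG u) p ^ 2),
    (s - c * slope (formK u) (formG u) p) / √(1 + slope (formK u) (formG u) p ^ 2))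

theorem contDiffAt_frame (hu : ContDiffAt ℝ ∞ u p) (h0 : formG u p ≠ 0) :
    ContDiffAt ℝ ∞ (frame c s u) p := by
  have hσ : ContDiffAt ℝ ∞ (slope (formK u) (formG u)) p :=
    (contDiffAt_formK hu).div (contDiffAt_formG hu) h0
  have hr : ContDiffAt ℝ ∞ (fun q => √(1 + slope (formK u) (formG u) q ^ 2)) p :=
    (contDiffAt_const.add (hσ.pow 2)).sqrt (by positivity)
  exact ((contDiffAt_const.add (contDiffAt_const.mul hσ)).div hr (by positivity)).prodMk
    ((contDiffAt_const.sub (contDiffAt_const.mul hσ)).div hr (by positivity))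

theorem isUnit₂_frame (hφ : IsGraphChart X φ c s u) (p : ℝ × ℝ) : IsUnit₂ (frame c s u p) := by
  simp only [IsUnit₂, frame]
  rw [div_pow, div_pow, Real.sq_sqrt (by positivity)]
  field_simp
  linear_combination (1 + slope (formK u) (formG u) p ^ 2) * hφ.unit

theorem horizontal_frame (hφ : IsGraphChart X φ c s u) (hX : IsImmersedSurface X)
    (hp : p ∈ φ.target) (h0 : formG u p ≠ 0) :
    horizontal (X (φ.symm p)) (frame c s u p) = fderiv ℝ (X ∘ φ.symm) p
      (1 / √(1 + slope (formK u) (formG u) p ^ 2),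
        -slope (formK u) (formG u) p / √(1 + slope (formK u) (formG u) p ^ 2)) := by
  set σ := slope (formK u) (formG u) with hσ
  have hr : √(1 + σ p ^ 2) ≠ 0 := by positivity
  have hkg : σ p * formG u p = formK u p := div_mul_cancel₀ _ h0
  simp only [formG, formK] at hkg
  rw [hφ.fderiv_eq hX hp, hφ.eq p hp]
  simp only [horizontal, frame, ← hσ]
  refine Prod.ext ?_ (Prod.ext ?_ ?_)
  · simp only; ring
  · simp only; ring
  · simp only
    field_simp
    linear_combination (p.2 + σ p * p.1) * hφ.unit + hkg

theorem alpha_mem_tangentPlane (hφ : IsGraphChart X φ c s u) (hX : IsImmersedSurface X)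
    (hp : p ∈ φ.target) (h0 : formG u p ≠ 0) :
    horizontal (X (φ.symm p)) ((1 / (√(1 + slope (formK u) (formG u) p ^ 2) * formG u p)) •
      rot (frame c s u p)) + reeb ∈ tangentPlane X (φ.symm p) := by
  set σ := slope (formK u) (formG u) with hσ
  rw [tangentPlane_symm hX hφ.smooth_chart hp]
  have hr : √(1 + σ p ^ 2) ≠ 0 := by positivity
  have hr2 : √(1 + σ p ^ 2) ^ 2 = 1 + σ p ^ 2 := Real.sq_sqrt (by positivity)
  have hkg : σ p * formG u p = formK u p := div_mul_cancel₀ _ h0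
  -- The multiple of `(σ, 1)`, the normal to the characteristic direction, on which `k dx + g dy`
  -- equals `1`, the value of `Θ` on `α e₂ + T`.
  refine ⟨(σ p / ((1 + σ p ^ 2) * formG u p), 1 / ((1 + σ p ^ 2) * formG u p)), ?_⟩
  have h1 : dx u p = formK u p + p.2 := by simp [formK]
  have h2 : dy u p = formG u p - p.1 := by simp [formG]
  rw [hφ.fderiv_eq hX hp, hφ.eq p hp, h1, h2, ← hkg]
  have hs : 1 + σ p ^ 2 ≠ 0 := by positivity
  simp only [horizontal, frame, rot, reeb, ← hσ]
  refine Prod.ext ?_ (Prod.ext ?_ ?_)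
  · simp only [Prod.smul_mk, smul_eq_mul, Prod.mk_add_mk, add_zero, neg_div']
    field_simp
    rw [hr2]
    ring
  · simp only [Prod.smul_mk, smul_eq_mul, Prod.mk_add_mk, add_zero]
    field_simp
    rw [hr2]
    ring
  · simp only [Prod.smul_mk, smul_eq_mul, Prod.mk_add_mk]
    field_simp
    rw [hr2]
    field_simp
    linear_combination (p.1 - σ p * p.2) * hφ.unit

/-- The curl condition is the symmetry of second derivatives of `u`. For minimality, `frame` is a
characteristic field on `g ≠ 0`; vanishing curvature makes its components stationary along `e₁`,
which is the direction `(1, -σ)` in the chart, and `σ` is a function of these components. -/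
theorem isPMinimalForm (hφ : IsGraphChart X φ c s u) (hX : IsImmersedSurface X)
    (hmin : IsPMinimal X) : IsPMinimalForm φ.target (formK u) (formG u) where
  isOpen := φ.open_target
  smooth_k p hp := contDiffAt_formK (hφ.contDiffAt_u hX hp)
  smooth_g p hp := contDiffAt_formG (hφ.contDiffAt_u hX hp)
  curl p hp := by
    have hu := hφ.contDiffAt_u hX hp
    rw [dx_formG hu, dy_formK hu, dx_dy_comm hu]
    ring
  minimal p hp h0 := by
    set σ := slope (formK u) (formG u) with hσ
    set O : Set (ℝ × ℝ) := {q ∈ φ.target | formG u q ≠ 0} with hO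
    have hOo : IsOpen O := by
      rw [isOpen_iff_mem_nhds]
      rintro q ⟨hq, hq0⟩
      exact (show ∀ᶠ r in 𝓝 q, r ∈ φ.target from φ.open_target.mem_nhds hq).and
        ((contDiffAt_formG (hφ.contDiffAt_u hX hq)).continuousAt.eventually_ne hq0)
    set U : Set M := φ.source ∩ φ ⁻¹' O
    set h : M → ℝ × ℝ := fun q => frame c s u (φ q) with hh
    have hunit := hφ.unit
    have hsurj : ∀ q ∈ U, ∃ p' ∈ O, q = φ.symm p' ∧ φ q = p' := fun q hq =>
      ⟨φ q, hq.2, (φ.left_inv hq.1).symm, rfl⟩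
    have hhor : ∀ p' ∈ O, horizontal (X (φ.symm p')) (frame c s u p')
        = fderiv ℝ (X ∘ φ.symm) p' (1 / √(1 + σ p' ^ 2), -σ p' / √(1 + σ p' ^ 2)) :=
      fun p' hp' => hφ.horizontal_frame hX hp'.1 hp'.2
    have hchar : IsCharacteristicField X U h := by
      refine ⟨φ.isOpen_inter_preimage hOo, ?_, ?_, ?_, ?_⟩
      · intro q hq hs
        obtain ⟨p', hp', rfl, -⟩ := hsurj q hq
        exact hp'.2 (hφ.form_eq_zero hX hp'.1 hs).2
      · intro q hq
        have h1 : ContMDiffAt 𝓘(ℝ, ℝ × ℝ) 𝓘(ℝ, ℝ × ℝ) ∞ (frame c s u) (φ q) :=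
          (contDiffAt_frame (hφ.contDiffAt_u hX hq.2.1) hq.2.2).contMDiffAt
        exact (h1.comp q (contMDiffAt_of_mem_maximalAtlas hφ.smooth_chart hq.1)).contMDiffWithinAt
      · intro q hq
        exact hφ.isUnit₂_frame (φ q)
      · intro q hq
        obtain ⟨p', hp', rfl, he⟩ := hsurj q hq
        rw [tangentPlane_symm hX hφ.smooth_chart hp'.1]
        simp only [hh]
        rw [he, hhor p' hp']
        exact mem_range_self _
    have hpO : p ∈ O := ⟨hp, h0⟩
    have hpU : φ.symm p ∈ U := ⟨φ.map_target hp, by simpa [φ.right_inv hp] using hpO⟩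
    set v : ℝ × ℝ := (1 / √(1 + σ p ^ 2), -σ p / √(1 + σ p ^ 2)) with hv
    have hXd : MDifferentiableAt 𝓘(ℝ, ℝ × ℝ) 𝓘(ℝ, H1) X (φ.symm p) :=
      (hX.smooth _).mdifferentiableAt (by simp)
    have hH := hmin U h hchar (φ.symm p) hpU
      (mfderiv 𝓘(ℝ, ℝ × ℝ) 𝓘(ℝ, ℝ × ℝ) φ.symm p v) (by
        rw [← fderiv_comp_symm hφ.smooth_chart hp hXd]
        simp only [hh]
        rw [φ.right_inv hp, hhor p hpO])
    have hu := hφ.contDiffAt_u hX hp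
    have hfr := contDiffAt_frame (c := c) (s := s) hu h0
    have hrot : ContDiffAt ℝ ∞ (fun q => rot (frame c s u q)) p := hfr.snd.neg.prodMk hfr.fst
    have hrotM : MDifferentiableAt 𝓘(ℝ, ℝ × ℝ) 𝓘(ℝ, ℝ × ℝ) (fun q => rot (h q)) (φ.symm p) := by
      have h1 : MDifferentiableAt 𝓘(ℝ, ℝ × ℝ) 𝓘(ℝ, ℝ × ℝ) (fun q => rot (frame c s u q))
          (φ (φ.symm p)) := by
        rw [φ.right_inv hp]
        exact (hrot.differentiableAt (by simp)).mdifferentiableAt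
      exact h1.comp _ ((contMDiffAt_of_mem_maximalAtlas hφ.smooth_chart
        (φ.map_target hp)).mdifferentiableAt (by simp))
    have hz := (fderiv_comp_symm hφ.smooth_chart hp hrotM v).trans hH
    have hev : (fun q => rot (h q)) ∘ φ.symm =ᶠ[𝓝 p] fun q => rot (frame c s u q) := by
      filter_upwards [φ.open_target.mem_nhds hp] with q hq
      simp [hh, φ.right_inv hq]
    rw [hev.fderiv_eq] at hz
    have hd1 := hfr.fst.diff
    have hd2 := hfr.snd.diff
    have hz2 : fderiv ℝ (fun q => rot (frame c s u q)) p v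
        = (-fderiv ℝ (fun q => (frame c s u q).2) p v, fderiv ℝ (fun q => (frame c s u q).1) p v) := by
      have := (hd2.hasFDerivAt.neg.prodMk hd1.hasFDerivAt).fderiv
      refine (congrArg (fun L => L v) this).trans ?_
      simp
    rw [hz2] at hz
    have hz1 : fderiv ℝ (fun q => (frame c s u q).1) p v = 0 := by
      have := congrArg Prod.snd hz
      simpa using this
    have hz2 : fderiv ℝ (fun q => (frame c s u q).2) p v = 0 := by
      have := congrArg Prod.fst hz
      simpa using this
    -- The slope is recovered rationally from the components of `e₁`, so the square root in `frame`
    -- never has to be differentiated.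
    have hσev : σ = fun q => (s * (frame c s u q).1 - c * (frame c s u q).2) /
        (c * (frame c s u q).1 + s * (frame c s u q).2) := by
      funext q
      have hr : √(1 + σ q ^ 2) ≠ 0 := by positivity
      have e1 : s * (frame c s u q).1 - c * (frame c s u q).2 = σ q / √(1 + σ q ^ 2) := by
        simp only [frame, ← hσ]
        field_simp
        linear_combination σ q * hunit
      have e2 : c * (frame c s u q).1 + s * (frame c s u q).2 = 1 / √(1 + σ q ^ 2) := by
        simp only [frame, ← hσ]
        field_simp
        linear_combination hunit
      rw [e1, e2]
      field_simp
    have hden : c * (frame c s u p).1 + s * (frame c s u p).2 ≠ 0 := by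
      have e2 : c * (frame c s u p).1 + s * (frame c s u p).2 = 1 / √(1 + σ p ^ 2) := by
        simp only [frame, ← hσ]
        field_simp
        linear_combination hunit
      rw [e2]
      positivity
    have hDσ : fderiv ℝ σ p v = 0 := by
      rw [hσev, fderiv_div_apply ((hd1.const_mul s).fun_sub (hd2.const_mul c))
        ((hd1.const_mul c).fun_add (hd2.const_mul s)) hden,
        fderiv_fun_sub (hd1.const_mul s) (hd2.const_mul c),
        fderiv_fun_add (hd1.const_mul c) (hd2.const_mul s),
        fderiv_const_mul hd1, fderiv_const_mul hd2, fderiv_const_mul hd1, fderiv_const_mul hd2]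
      simp [hz1, hz2]
    have hfd : fderiv ℝ σ p v = (fderiv ℝ (formK u) p v * formG u p
        - formK u p * fderiv ℝ (formG u) p v) / formG u p ^ 2 :=
      fderiv_div_apply (contDiffAt_formK hu).diff (contDiffAt_formG hu).diff h0 v
    rw [hDσ, fderiv_apply_eq, fderiv_apply_eq] at hfd
    have hr : √(1 + σ p ^ 2) ≠ 0 := by positivity
    have hkg : σ p * formG u p = formK u p := div_mul_cancel₀ _ h0
    simp only [hv] at hfd
    field_simp at hfd
    rw [← hkg] at hfd ⊢
    linear_combination -formG u p * hfd

end IsGraphChart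

end Graph

/-! ### Reading the sign of `ω g` off the type -/

section Types

variable {M : Type*} [TopologicalSpace M] [ChartedSpace (ℝ × ℝ) M] {X : M → H1}
  {φ ψ : OpenPartialHomeomorph M (ℝ × ℝ)} {c s : ℝ} {u : ℝ × ℝ → ℝ} {c₁ c₂ : ℝ → ℝ}

/-- The coordinate vector `∂_x` of a compatible chart, seen in a graph chart, and the contact
form on it. -/
theorem IsGraphChart.compatible_frame (hφ : IsGraphChart X φ c s u) (hX : IsImmersedSurface X)
    {h : ℝ × ℝ → ℝ × ℝ} {α : ℝ × ℝ → ℝ} (hc : IsCompatible X ψ h) (hα : IsAlphaFunction X ψ h α)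
    {p : ℝ × ℝ} (hp : p ∈ ψ.target) (hpφ : ψ.symm p ∈ φ.source) {v : ℝ × ℝ}
    (hv : v = fderiv ℝ (φ ∘ ψ.symm) p (1, 0)) :
    v.1 ^ 2 + v.2 ^ 2 = 1 ∧
    v.1 * formK u (φ (ψ.symm p)) + v.2 * formG u (φ (ψ.symm p)) = 0 ∧
    α p * (v.1 * formG u (φ (ψ.symm p)) - v.2 * formK u (φ (ψ.symm p))) = 1 := by
  set z := φ (ψ.symm p) with hz
  have hzt : z ∈ φ.target := φ.map_source hpφ
  have hzs : φ.symm z = ψ.symm p := φ.left_inv hpφ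
  have hev : X ∘ ψ.symm =ᶠ[𝓝 p] (X ∘ φ.symm) ∘ (φ ∘ ψ.symm) := by
    have : ∀ᶠ q in 𝓝 p, ψ.symm q ∈ φ.source :=
      (ψ.symm.continuousAt hp).eventually_mem (φ.open_source.mem_nhds hpφ)
    filter_upwards [this] with q hq
    simp [φ.left_inv hq]
  have hτ : DifferentiableAt ℝ (φ ∘ ψ.symm) p :=
    (contDiffAt_transition hc.smooth_chart hφ.smooth_chart hp hpφ).differentiableAt (by simp)
  have hXφ : DifferentiableAt ℝ (X ∘ φ.symm) ((φ ∘ ψ.symm) p) :=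
    (contDiffAt_comp_symm hφ.smooth_chart hzt (hX.smooth _)).differentiableAt (by simp)
  have hpx := hc.partial_x p hp
  rw [hev.fderiv_eq, fderiv_comp p hXφ hτ, ContinuousLinearMap.comp_apply, ← hv] at hpx
  change fderiv ℝ (X ∘ φ.symm) z v = _ at hpx
  have hcf := hφ.contactForm_fderiv hX hzt v
  rw [hpx, hzs, contactForm_horizontal] at hcf
  rw [hφ.fderiv_eq hX hzt] at hpx
  have e1 : (h p).1 = c * v.1 - s * v.2 := (congrArg Prod.fst hpx).symm
  have e2 : (h p).2 = s * v.1 + c * v.2 := (congrArg (fun w => w.2.1) hpx).symm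
  have hu := hc.unit p hp
  simp only [IsUnit₂, e1, e2] at hu
  refine ⟨?_, hcf.symm, ?_⟩
  · linear_combination hu - (v.1 ^ 2 + v.2 ^ 2) * hφ.unit
  · have hmem := hα p hp
    rw [← hzs, tangentPlane_symm hX hφ.smooth_chart hzt] at hmem
    obtain ⟨w, hw⟩ := hmem
    have hcw := hφ.contactForm_fderiv hX hzt w
    rw [hw] at hcw
    have hone : contactForm (X (φ.symm z)) (horizontal (X (φ.symm z)) (α p • rot (h p)) + reeb)
        = 1 := by
      simp [contactForm, horizontal, reeb]; ring
    rw [hone] at hcw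
    rw [hφ.fderiv_eq hX hzt] at hw
    have f1 : c * w.1 - s * w.2 = α p * -(s * v.1 + c * v.2) := by
      have := congrArg Prod.fst hw
      simpa [horizontal, reeb, rot, e1, e2] using this
    have f2 : s * w.1 + c * w.2 = α p * (c * v.1 - s * v.2) := by
      have := congrArg (fun w => w.2.1) hw
      simpa [horizontal, reeb, rot, e1, e2] using this
    -- Undoing the rotation gives `w = α J v`; the contact form takes the value `1` on this vector.
    have hw1 : w.1 = -(α p * v.2) := by
      linear_combination c * f1 + s * f2 - (w.1 + α p * v.2) * hφ.unit
    have hw2 : w.2 = α p * v.1 := by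
      linear_combination c * f2 - s * f1 - (w.2 - α p * v.1) * hφ.unit
    rw [hw1, hw2] at hcw
    linear_combination -hcw

/-- In a chart of general type the invariant `-ω g` of the graph is `(w² + c₂) / w²`, where
`w = x + c₁`. -/
theorem IsGraphChart.invariant_eq (hφ : IsGraphChart X φ c s u) (hX : IsImmersedSurface X)
    (H : IsPMinimalForm φ.target (formK u) (formG u)) (hψ : IsGeneralChart X ψ c₁ c₂) {q : M}
    (hq : q ∈ ψ.source) (hqφ : q ∈ φ.source) (h0 : formG u (φ q) ≠ 0) :
    -(spread (formK u) (formG u) (φ q) * formG u (φ q)) * ((ψ q).1 + c₁ (ψ q).2) ^ 2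
      = ((ψ q).1 + c₁ (ψ q).2) ^ 2 + c₂ (ψ q).2 ∧ (ψ q).1 + c₁ (ψ q).2 ≠ 0 := by
  obtain ⟨h, hc, hα⟩ := hψ.exists_compatible
  set p := ψ q with hp
  have hpt : p ∈ ψ.target := ψ.map_source hq
  have hsp : ψ.symm p = q := ψ.left_inv hq
  have hnear : ∀ᶠ p' in 𝓝 p, p' ∈ ψ.target ∧ ψ.symm p' ∈ φ.source :=
    (show ∀ᶠ p' in 𝓝 p, p' ∈ ψ.target from ψ.open_target.mem_nhds hpt).and
      ((ψ.symm.continuousAt hpt).eventually_mem (φ.open_source.mem_nhds (by rwa [hsp])))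
  set τ := φ ∘ ψ.symm with hτ
  have hτp : τ p = φ q := by simp [hτ, hsp]
  set k := formK u with hk
  set g := formG u with hg
  set α : ℝ × ℝ → ℝ := fun p => (p.1 + c₁ p.2) / ((p.1 + c₁ p.2) ^ 2 + c₂ p.2) with hαdef
  set v := fderiv ℝ τ p (1, 0) with hv
  obtain ⟨v1, v2, v3⟩ := hφ.compatible_frame hX hc hα hpt (by rwa [hsp]) hv
  rw [hsp] at v2 v3
  -- As `v` is a unit vector annihilated by `(k, g)`, the number `v₁ g - v₂ k = 1 / α` has square
  -- `k² + g²`. The identity is established on a neighbourhood in order to be differentiated.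
  have hE : ∀ᶠ p' in 𝓝 p, (k (τ p') * k (τ p') + g (τ p') * g (τ p')) * α p' ^ 2 = 1 := by
    filter_upwards [hnear] with p' hp'
    obtain ⟨a1, a2, a3⟩ := hφ.compatible_frame hX hc hα hp'.1 hp'.2 rfl
    set v' := fderiv ℝ τ p' (1, 0)
    change v'.1 * k (τ p') + v'.2 * g (τ p') = 0 at a2
    change α p' * (v'.1 * g (τ p') - v'.2 * k (τ p')) = 1 at a3
    have : k (τ p') * k (τ p') + g (τ p') * g (τ p')
        = (v'.1 * g (τ p') - v'.2 * k (τ p')) ^ 2 := by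
      linear_combination -(k (τ p') ^ 2 + g (τ p') ^ 2) * a1
        + (v'.1 * k (τ p') + v'.2 * g (τ p')) * a2
    rw [this, ← mul_pow, mul_comm, a3, one_pow]
  have hαp : α p ≠ 0 := by
    intro h
    rw [h] at v3
    simp at v3
  set C₁ := c₁ p.2
  set C₂ := c₂ p.2
  have hden : (p.1 + C₁) ^ 2 + C₂ ≠ 0 := hψ.denom_ne_zero p hpt
  have hw : p.1 + C₁ ≠ 0 := by
    intro h
    apply hαp
    change (p.1 + C₁) / ((p.1 + C₁) ^ 2 + C₂) = 0
    rw [h, zero_div]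
  refine ⟨?_, hw⟩
  -- differentiate `k² + g² = α⁻²` along the `x`-line
  have hline : Tendsto (fun t : ℝ => (t, p.2)) (𝓝 p.1) (𝓝 p) := by
    have : ContinuousAt (fun t : ℝ => (t, p.2)) p.1 := by fun_prop
    exact this
  have hzt : φ q ∈ φ.target := φ.map_source hqφ
  have dk := (H.smooth_k _ hzt).diff
  have dg := (H.smooth_g _ hzt).diff
  have hτd : DifferentiableAt ℝ τ p :=
    (contDiffAt_transition hc.smooth_chart hφ.smooth_chart hpt (by rwa [hsp])).differentiableAt
      (by simp)
  have hτl : HasDerivAt (fun t : ℝ => τ (t, p.2)) v p.1 := by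
    have h1 : HasDerivAt (fun t : ℝ => (t, p.2)) ((1 : ℝ), (0 : ℝ)) p.1 :=
      (hasDerivAt_id p.1).prodMk (hasDerivAt_const p.1 p.2)
    exact hτd.hasFDerivAt.comp_hasDerivAt p.1 h1
  have hkl : HasDerivAt (fun t : ℝ => k (τ (t, p.2))) (fderiv ℝ k (φ q) v) p.1 := by
    have : HasFDerivAt k (fderiv ℝ k (φ q)) (τ (p.1, p.2)) := by
      have e : τ (p.1, p.2) = φ q := hτp
      rw [e]; exact dk.hasFDerivAt
    exact this.comp_hasDerivAt p.1 hτl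
  have hgl : HasDerivAt (fun t : ℝ => g (τ (t, p.2))) (fderiv ℝ g (φ q) v) p.1 := by
    have : HasFDerivAt g (fderiv ℝ g (φ q)) (τ (p.1, p.2)) := by
      have e : τ (p.1, p.2) = φ q := hτp
      rw [e]; exact dg.hasFDerivAt
    exact this.comp_hasDerivAt p.1 hτl
  have hEl := (hkl.fun_mul hkl).fun_add (hgl.fun_mul hgl)
  -- With `y` frozen, `c₁` and `c₂` are constants, so no regularity of these functions is needed.
  have hwl : HasDerivAt (fun t : ℝ => t + C₁) 1 p.1 := (hasDerivAt_id p.1).add_const C₁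
  have hRl := (((hwl.fun_pow 2).add_const C₂).fun_div hwl hw).fun_pow 2
  have heq : (fun t : ℝ => k (τ (t, p.2)) * k (τ (t, p.2)) + g (τ (t, p.2)) * g (τ (t, p.2)))
      =ᶠ[𝓝 p.1] fun t => (((t + C₁) ^ 2 + C₂) / (t + C₁)) ^ 2 := by
    have hne : ∀ᶠ t in 𝓝 p.1, t + C₁ ≠ 0 := hwl.continuousAt.eventually_ne hw
    filter_upwards [hline.eventually hE, hne, hline.eventually hnear] with t ht hnt hmem
    have hdt : (t + C₁) ^ 2 + C₂ ≠ 0 := hψ.denom_ne_zero (t, p.2) hmem.1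
    change _ * ((t + C₁) / ((t + C₁) ^ 2 + C₂)) ^ 2 = 1 at ht
    rw [div_pow, eq_div_iff (pow_ne_zero 2 hnt)]
    rw [div_pow, ← mul_div_assoc, div_eq_iff (pow_ne_zero 2 hdt), one_mul] at ht
    exact ht
  have hder := hEl.unique (hRl.congr_of_eventuallyEq heq)
  have hτ' : τ (p.1, p.2) = φ q := hτp
  rw [hτ'] at hder
  set D := v.1 * g (φ q) - v.2 * k (φ q) with hD
  have hDα : D = ((p.1 + C₁) ^ 2 + C₂) / (p.1 + C₁) := by
    have : (p.1 + C₁) / ((p.1 + C₁) ^ 2 + C₂) * D = 1 := v3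
    field_simp at this ⊢
    linear_combination this
  have hDne : D ≠ 0 := by
    rw [hDα]; positivity
  have hkD : k (φ q) = -(D * v.2) := by
    rw [hD]; linear_combination v.1 * v2 - k (φ q) * v1
  have hgD : g (φ q) = D * v.1 := by
    rw [hD]; linear_combination v.2 * v2 - g (φ q) * v1
  have hdg := H.deriv_g hzt h0
  have hmin := H.minimal _ hzt h0
  set σ := slope k g (φ q)
  have hkσ : k (φ q) = σ * g (φ q) := (div_mul_cancel₀ _ h0).symm
  have hv2 : v.2 = -(σ * v.1) := by
    have h3 : D * v.2 = D * -(σ * v.1) := by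
      linear_combination hkD - hkσ - σ * hgD
    exact mul_left_cancel₀ hDne h3
  have hk' : dx k (φ q) - σ * dy k (φ q) = σ * (dx g (φ q) - σ * dy g (φ q)) := by
    rw [hkσ] at hmin
    apply mul_left_cancel₀ (pow_ne_zero 2 h0)
    linear_combination hmin
  rw [← hDα, fderiv_apply_eq, fderiv_apply_eq] at hder
  have hunit : v.1 ^ 2 * (1 + σ ^ 2) = 1 := by rw [hv2] at v1; linear_combination v1
  set W := p.1 + C₁
  -- Both sides are half the derivative of `k² + g² = D²`: the left from `g' = 2 + ω g` and the
  -- constancy of `σ`, the right from `D = (W² + C₂) / W`.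
  have hA : D * (2 + spread k g (φ q) * g (φ q)) = D * ((2 * W * W - (W ^ 2 + C₂)) / W ^ 2) := by
    have e1 : v.1 * dx k (φ q) + v.2 * dy k (φ q) = v.1 * (σ * (dx g (φ q) - σ * dy g (φ q))) := by
      rw [hv2, ← hk']; ring
    have e2 : v.1 * dx g (φ q) + v.2 * dy g (φ q) = v.1 * (dx g (φ q) - σ * dy g (φ q)) := by
      rw [hv2]; ring
    rw [e1, e2, hkσ, hdg] at hder
    push_cast at hder
    simp only [pow_one, mul_one] at hder
    linear_combination hder / 2 - D * (2 + spread k g (φ q) * g (φ q)) * hunit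
      - v.1 * (1 + σ ^ 2) * (2 + spread k g (φ q) * g (φ q)) * hgD
  have hB := mul_left_cancel₀ hDne hA
  rw [eq_div_iff (pow_ne_zero 2 hw)] at hB
  linear_combination -hB

/-- Both alternatives of type II say `|w| > √(-c₂)`, so the invariant `-ω g = (w² + c₂) / w²` is
positive. -/
theorem IsGraphChart.invariant_pos_of_typeII (hφ : IsGraphChart X φ c s u)
    (hX : IsImmersedSurface X) (H : IsPMinimalForm φ.target (formK u) (formG u)) {S : Set M}
    (hS : IsTypeII X S) {q : M} (hq : q ∈ S) (hqφ : q ∈ φ.source) (h0 : formG u (φ q) ≠ 0) :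
    spread (formK u) (formG u) (φ q) * formG u (φ q) < 0 := by
  obtain ⟨ψ, c₁, c₂, hqψ, -, hgen, hneg, hside⟩ := hS q hq
  obtain ⟨he, hw⟩ := hφ.invariant_eq hX H hgen hqψ hqφ h0
  have hp := ψ.map_source hqψ
  have hc := hneg _ hp
  set p := ψ q
  have hsq : √(-c₂ p.2) ^ 2 = -c₂ p.2 := Real.sq_sqrt (by linarith)
  have hnn := Real.sqrt_nonneg (-c₂ p.2)
  have hpos : 0 < (p.1 + c₁ p.2) ^ 2 + c₂ p.2 := by
    rcases hside with h | h
    · nlinarith [h p hp]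
    · nlinarith [h p hp]
  rw [← he] at hpos
  have := pos_of_mul_pos_left hpos (sq_nonneg _)
  linarith

/-- Type III says `|w| < √(-c₂)`, which makes the invariant negative. -/
theorem IsGraphChart.invariant_neg_of_typeIII (hφ : IsGraphChart X φ c s u)
    (hX : IsImmersedSurface X) (H : IsPMinimalForm φ.target (formK u) (formG u)) {S : Set M}
    (hS : IsTypeIII X S) {q : M} (hq : q ∈ S) (hqφ : q ∈ φ.source) (h0 : formG u (φ q) ≠ 0) :
    0 < spread (formK u) (formG u) (φ q) * formG u (φ q) := by
  obtain ⟨ψ, c₁, c₂, hqψ, -, hgen, hneg, hside⟩ := hS q hq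
  obtain ⟨he, hw⟩ := hφ.invariant_eq hX H hgen hqψ hqφ h0
  have hp := ψ.map_source hqψ
  have hc := hneg _ hp
  obtain ⟨h1, h2⟩ := hside _ hp
  set p := ψ q
  have hsq : √(-c₂ p.2) ^ 2 = -c₂ p.2 := Real.sq_sqrt (by linarith)
  have hnn := Real.sqrt_nonneg (-c₂ p.2)
  have hlt : (p.1 + c₁ p.2) ^ 2 + c₂ p.2 < 0 := by nlinarith
  rw [← he] at hlt
  have := sq_nonneg (p.1 + c₁ p.2)
  by_contra hcon
  nlinarith

end Types

/-! ### Charts adapted to the characteristic lines -/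

/-- A function whose first partial derivative vanishes is constant on horizontal segments. -/
theorem eq_of_dx_eq_zero {f : ℝ × ℝ → ℝ} {p₀ p : ℝ × ℝ} {r : ℝ}
    (hf : ∀ q ∈ Metric.ball p₀ r, DifferentiableAt ℝ f q ∧ dx f q = 0)
    (hp : p ∈ Metric.ball p₀ r) : f p = f (p₀.1, p.2) := by
  obtain ⟨h1, h2⟩ := mem_ball_prod.1 hp
  have hr : 0 < r := (abs_nonneg _).trans_lt h1
  have hm : ∀ t ∈ Metric.ball p₀.1 r, (t, p.2) ∈ Metric.ball p₀ r := fun t ht =>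
    mem_ball_prod.2 ⟨by simpa [Real.dist_eq] using ht, h2⟩
  have hd : ∀ t ∈ Metric.ball p₀.1 r, HasDerivAt (fun t => f (t, p.2)) 0 t := by
    intro t ht
    have := hf _ (hm t ht)
    rw [← this.2]
    exact hasDerivAt_comp_horizontal this.1
  exact Metric.isOpen_ball.is_const_of_deriv_eq_zero (convex_ball p₀.1 r).isPreconnected
    (f := fun t => f (t, p.2)) (fun t ht => (hd t ht).differentiableAt.differentiableWithinAt)
    (fun t ht => (hd t ht).deriv) (by simpa [Real.dist_eq] using h1) (Metric.mem_ball_self hr)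

/-- The length of `(1, -k / g)`. -/
noncomputable def speed (k g : ℝ × ℝ → ℝ) (p : ℝ × ℝ) : ℝ := √(1 + slope k g p ^ 2)

/-- The signed distance on the characteristic line from the centre of the line. -/
noncomputable def position (k g : ℝ × ℝ → ℝ) (p : ℝ × ℝ) : ℝ := -(speed k g p / spread k g p)

/-- The constant `c₂` of a characteristic line. -/
noncomputable def lineConst (k g : ℝ × ℝ → ℝ) (p : ℝ × ℝ) : ℝ :=
  position k g p * position k g p * (-1 - spread k g p * g p)

theorem speed_pos (k g : ℝ × ℝ → ℝ) (p : ℝ × ℝ) : 0 < speed k g p := by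
  unfold speed; positivity

namespace IsPMinimalForm

variable {Ω : Set (ℝ × ℝ)} {k g : ℝ × ℝ → ℝ} {p v : ℝ × ℝ}

theorem contDiffAt_speed (H : IsPMinimalForm Ω k g) (hp : p ∈ Ω) (h0 : g p ≠ 0) :
    ContDiffAt ℝ ∞ (speed k g) p :=
  (contDiffAt_const.add ((H.contDiffAt_slope hp h0).pow 2)).sqrt (by positivity)

theorem contDiffAt_position (H : IsPMinimalForm Ω k g) (hp : p ∈ Ω) (h0 : g p ≠ 0)
    (hω : spread k g p ≠ 0) : ContDiffAt ℝ ∞ (position k g) p :=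
  ((H.contDiffAt_speed hp h0).div (H.contDiffAt_spread hp h0) hω).neg

theorem contDiffAt_lineConst (H : IsPMinimalForm Ω k g) (hp : p ∈ Ω) (h0 : g p ≠ 0)
    (hω : spread k g p ≠ 0) : ContDiffAt ℝ ∞ (lineConst k g) p :=
  ((H.contDiffAt_position hp h0 hω).mul (H.contDiffAt_position hp h0 hω)).mul
    (contDiffAt_const.sub ((H.contDiffAt_spread hp h0).mul (H.smooth_g p hp)))

theorem fderiv_speed (H : IsPMinimalForm Ω k g) (hp : p ∈ Ω) (h0 : g p ≠ 0)
    (hv : fderiv ℝ (slope k g) p v = 0) : fderiv ℝ (speed k g) p v = 0 := by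
  have h1 := (H.contDiffAt_slope hp h0).diff.hasFDerivAt
  have h2 := ((h1.pow 2).const_add 1).sqrt (by positivity)
  have h3 : fderiv ℝ (speed k g) p = _ := h2.fderiv
  rw [h3]
  simp [hv]

theorem fderiv_slope_eq_zero_iff (H : IsPMinimalForm Ω k g) (hp : p ∈ Ω) (h0 : g p ≠ 0)
    (hω : spread k g p ≠ 0) :
    fderiv ℝ (slope k g) p v = 0 ↔ v.2 = -(v.1 * slope k g p) := by
  rw [fderiv_apply_eq, H.dx_slope hp h0, H.dy_slope hp h0]
  constructor
  · intro h
    apply mul_right_cancel₀ hω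
    linear_combination h
  · intro h
    rw [h]; ring

theorem fderiv_spread (H : IsPMinimalForm Ω k g) (hp : p ∈ Ω) (h0 : g p ≠ 0)
    (hv : v.2 = -(v.1 * slope k g p)) :
    fderiv ℝ (spread k g) p v = v.1 * spread k g p ^ 2 := by
  rw [fderiv_apply_eq, hv, ← H.riccati hp h0]
  ring

theorem fderiv_g (H : IsPMinimalForm Ω k g) (hp : p ∈ Ω) (h0 : g p ≠ 0)
    (hv : v.2 = -(v.1 * slope k g p)) :
    fderiv ℝ g p v = v.1 * (2 + spread k g p * g p) := by
  rw [fderiv_apply_eq, hv, ← H.deriv_g hp h0]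
  ring

/-- `position` is a unit speed parameter of the characteristic lines. -/
theorem fderiv_position (H : IsPMinimalForm Ω k g) (hp : p ∈ Ω) (h0 : g p ≠ 0)
    (hω : spread k g p ≠ 0) (hv : v.2 = -(v.1 * slope k g p)) (hs : v.1 * speed k g p = 1) :
    fderiv ℝ (position k g) p v = 1 := by
  have h1 := fderiv_div_apply (H.contDiffAt_speed hp h0).diff (H.contDiffAt_spread hp h0).diff hω v
  have h2 : fderiv ℝ (position k g) p v
      = -fderiv ℝ (fun q => speed k g q / spread k g q) p v := by
    have : position k g = fun q => -(speed k g q / spread k g q) := rfl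
    rw [this, fderiv_fun_neg]
    rfl
  rw [h2, h1, H.fderiv_speed hp h0 ((H.fderiv_slope_eq_zero_iff hp h0 hω).2 hv),
    H.fderiv_spread hp h0 hv]
  field_simp
  linear_combination spread k g p * hs

/-- `lineConst` is constant on the characteristic lines. -/
theorem fderiv_lineConst (H : IsPMinimalForm Ω k g) (hp : p ∈ Ω) (h0 : g p ≠ 0)
    (hω : spread k g p ≠ 0) (hv : v.2 = -(v.1 * slope k g p)) (hs : v.1 * speed k g p = 1) :
    fderiv ℝ (lineConst k g) p v = 0 := by
  have d1 := (H.contDiffAt_position hp h0 hω).diff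
  have d2 := (H.contDiffAt_spread hp h0).diff
  have d3 := (H.smooth_g p hp).diff
  have e : lineConst k g = fun q => position k g q * position k g q * (-1 - spread k g q * g q) :=
    rfl
  rw [e, fderiv_fun_mul (d1.fun_mul d1) ((differentiableAt_const _).fun_sub (d2.fun_mul d3)),
    fderiv_fun_mul d1 d1, fderiv_fun_sub (differentiableAt_const _) (d2.fun_mul d3),
    fderiv_fun_mul d2 d3]
  simp only [fderiv_fun_const, Pi.zero_apply, zero_sub, add_apply,
    smul_apply, neg_apply, smul_eq_mul]
  rw [H.fderiv_position hp h0 hω hv hs, H.fderiv_spread hp h0 hv, H.fderiv_g hp h0 hv]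
  have hw : position k g p * spread k g p * v.1 = -1 := by
    simp only [position]
    field_simp
    linear_combination -hs
  -- With `w` for `position`, the derivative factors as `-2 w (1 + ω g) (1 + w ω v₁)`, and the last
  -- factor is zero.
  linear_combination (-2 * position k g p * (1 + spread k g p * g p)) * hw

/-- The map to the coordinates given by arc length and slope. -/
noncomputable def straighten (k g : ℝ × ℝ → ℝ) (p : ℝ × ℝ) : ℝ × ℝ :=
  (p.1 * speed k g p, slope k g p)

theorem contDiffAt_straighten (H : IsPMinimalForm Ω k g) (hp : p ∈ Ω) (h0 : g p ≠ 0) :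
    ContDiffAt ℝ ∞ (straighten k g) p :=
  (contDiffAt_fst.mul (H.contDiffAt_speed hp h0)).prodMk (H.contDiffAt_slope hp h0)

theorem fderiv_straighten (H : IsPMinimalForm Ω k g) (hp : p ∈ Ω) (h0 : g p ≠ 0) (v : ℝ × ℝ) :
    fderiv ℝ (straighten k g) p v
      = (p.1 * fderiv ℝ (speed k g) p v + v.1 * speed k g p, fderiv ℝ (slope k g) p v) := by
  have hfst : HasFDerivAt (fun q : ℝ × ℝ => q.1) (ContinuousLinearMap.fst ℝ ℝ ℝ) p := hasFDerivAt_fst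
  have h := ((hfst.mul (H.contDiffAt_speed hp h0).diff.hasFDerivAt).prodMk
    (H.contDiffAt_slope hp h0).diff.hasFDerivAt).fderiv
  have h' : fderiv ℝ (straighten k g) p = _ := h
  rw [h']
  simp [mul_comm]

/-- Characteristic unit vectors in terms of `straighten`. -/
theorem fderiv_straighten_eq_iff (H : IsPMinimalForm Ω k g) (hp : p ∈ Ω) (h0 : g p ≠ 0)
    (hω : spread k g p ≠ 0) {a : ℝ} :
    fderiv ℝ (straighten k g) p v = (a, 0) ↔
      v.2 = -(v.1 * slope k g p) ∧ v.1 * speed k g p = a := by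
  rw [H.fderiv_straighten hp h0, Prod.mk.injEq, ← H.fderiv_slope_eq_zero_iff hp h0 hω]
  constructor
  · rintro ⟨h1, h2⟩
    rw [H.fderiv_speed hp h0 h2] at h1
    exact ⟨h2, by linear_combination h1⟩
  · rintro ⟨h1, h2⟩
    rw [H.fderiv_speed hp h0 h1]
    exact ⟨by linear_combination h2, h1⟩

end IsPMinimalForm

section Charts

variable {M : Type*} [TopologicalSpace M] [ChartedSpace (ℝ × ℝ) M]
  [IsManifold 𝓘(ℝ, ℝ × ℝ) ∞ M] {X : M → H1}
  {φ : OpenPartialHomeomorph M (ℝ × ℝ)} {c s : ℝ} {u : ℝ × ℝ → ℝ}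

/-- Away from the exceptional values of `ω g`, there are coordinates of general type. -/
theorem IsGraphChart.exists_generalChart (hφ : IsGraphChart X φ c s u) (hX : IsImmersedSurface X)
    (H : IsPMinimalForm φ.target (formK u) (formG u)) {q : M} (hq : q ∈ φ.source)
    {N : Set M} (hN : IsOpen N) (hqN : q ∈ N)
    (hNg : ∀ x ∈ N, x ∈ φ.source ∧ formG u (φ x) ≠ 0 ∧ spread (formK u) (formG u) (φ x) ≠ 0 ∧
      spread (formK u) (formG u) (φ x) * formG u (φ x) ≠ -1) :
    ∃ (ψ : OpenPartialHomeomorph M (ℝ × ℝ)) (c₁ c₂ : ℝ → ℝ), q ∈ ψ.source ∧ ψ.source ⊆ N ∧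
      IsGeneralChart X ψ c₁ c₂ ∧ ∀ p ∈ ψ.target,
        p.1 + c₁ p.2 = position (formK u) (formG u) (φ (ψ.symm p)) ∧
        c₂ p.2 = lineConst (formK u) (formG u) (φ (ψ.symm p)) := by
  set k := formK u with hk
  set g := formG u with hg
  have hz := φ.map_source hq
  obtain ⟨-, hq0, hqω, -⟩ := hNg q hqN
  -- Here `ω ≠ 0` is essential: it makes the slope a coordinate transverse to the characteristic
  -- lines.
  have hinj : Function.Injective (fderiv ℝ (IsPMinimalForm.straighten k g) (φ q)) := by
    rw [injective_iff_map_eq_zero]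
    intro v hv
    obtain ⟨h1, h2⟩ := (H.fderiv_straighten_eq_iff hz hq0 hqω (a := 0)).1 hv
    have h3 : v.1 = 0 := by
      rcases mul_eq_zero.1 h2 with h | h
      · exact h
      · exact absurd h (speed_pos k g _).ne'
    rw [h3] at h1
    exact Prod.ext h3 (by simpa using h1)
  have hsm : ∀ᶠ p in 𝓝 (φ q), ContDiffAt ℝ ∞ (IsPMinimalForm.straighten k g) p := by
    filter_upwards [H.eventually_mem hz hq0] with p hp
    exact H.contDiffAt_straighten hp.1 hp.2
  obtain ⟨ψ₀, hψ₀, hqψ₀, hsub₀, hψ₀e⟩ := exists_chart_comp hφ.smooth_chart hq hsm hinj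
  -- shrink the chart so that its image is a square and its domain lies in `N`
  have hT : IsOpen (ψ₀.target ∩ ψ₀.symm ⁻¹' N) := ψ₀.symm.isOpen_inter_preimage hN
  have hTq : ψ₀ q ∈ ψ₀.target ∩ ψ₀.symm ⁻¹' N :=
    ⟨ψ₀.map_source hqψ₀, by simpa [ψ₀.left_inv hqψ₀] using hqN⟩
  obtain ⟨r, hr, hball⟩ := Metric.isOpen_iff.1 hT _ hTq
  set p₀ := ψ₀ q
  have hWo : IsOpen (ψ₀.source ∩ ψ₀ ⁻¹' Metric.ball p₀ r) :=
    ψ₀.isOpen_inter_preimage Metric.isOpen_ball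
  set ψ := ψ₀.restr (ψ₀.source ∩ ψ₀ ⁻¹' Metric.ball p₀ r) with hψ
  have hψs : ψ.source = ψ₀.source ∩ ψ₀ ⁻¹' Metric.ball p₀ r := by
    rw [hψ, ψ₀.restr_source, hWo.interior_eq, ← inter_assoc, inter_self]
  have hψc : ∀ x, ψ x = ψ₀ x := fun _ => rfl
  have hψt : ψ.target = Metric.ball p₀ r := by
    ext p
    constructor
    · intro hp
      have := ψ.map_target hp
      rw [hψs] at this
      have h2 := this.2
      rw [mem_preimage, ← hψc, ψ.right_inv hp] at h2
      exact h2
    · intro hp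
      have hpt := (hball hp).1
      have : ψ₀.symm p ∈ ψ.source := by
        rw [hψs]
        exact ⟨ψ₀.map_target hpt, by rwa [mem_preimage, ψ₀.right_inv hpt]⟩
      have h3 := ψ.map_source this
      rwa [hψc, ψ₀.right_inv hpt] at h3
  have hψmem : ψ ∈ IsManifold.maximalAtlas 𝓘(ℝ, ℝ × ℝ) ∞ M :=
    restr_mem_maximalAtlas_of_isOpen hψ₀ hWo
  have hψN : ψ.source ⊆ N := by
    intro x hx
    rw [hψs] at hx
    have := (hball hx.2).2
    rwa [mem_preimage, ψ₀.left_inv hx.1] at this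
  have hqψ : q ∈ ψ.source := by
    rw [hψs]
    exact ⟨hqψ₀, Metric.mem_ball_self hr⟩
  have hψe : ∀ x ∈ ψ.source, ψ x = IsPMinimalForm.straighten k g (φ x) := by
    intro x hx
    rw [hψs] at hx
    exact hψ₀e x hx.1
  set τ := φ ∘ ψ.symm with hτ
  have hτN : ∀ p ∈ ψ.target, ψ.symm p ∈ N := fun p hp => hψN (ψ.map_target hp)
  have hτt : ∀ p ∈ ψ.target, τ p ∈ φ.target := fun p hp => φ.map_source (hNg _ (hτN p hp)).1
  have hτd : ∀ p ∈ ψ.target, DifferentiableAt ℝ τ p := fun p hp =>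
    (contDiffAt_transition hψmem hφ.smooth_chart hp (hNg _ (hτN p hp)).1).differentiableAt
      (by simp)
  have hvec : ∀ p ∈ ψ.target, (fderiv ℝ τ p (1, 0)).2
      = -((fderiv ℝ τ p (1, 0)).1 * slope k g (τ p)) ∧
      (fderiv ℝ τ p (1, 0)).1 * speed k g (τ p) = 1 := by
    intro p hp
    obtain ⟨-, h0, hω, -⟩ := hNg _ (hτN p hp)
    refine (H.fderiv_straighten_eq_iff (hτt p hp) h0 hω).1 ?_
    have hid : IsPMinimalForm.straighten k g ∘ τ =ᶠ[𝓝 p] id := by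
      filter_upwards [ψ.open_target.mem_nhds hp] with p' hp'
      simp only [Function.comp_apply, hτ, id]
      rw [← hψe _ (ψ.map_target hp'), ψ.right_inv hp']
    have h1 := hid.fderiv_eq (𝕜 := ℝ)
    rw [fderiv_comp p ((H.contDiffAt_straighten (hτt p hp) h0).differentiableAt (by simp))
      (hτd p hp), fderiv_id] at h1
    exact congrArg (fun L : (ℝ × ℝ) →L[ℝ] (ℝ × ℝ) => L (1, 0)) h1
  set C₁ : ℝ × ℝ → ℝ := fun p => position k g (τ p) - p.1 with hC₁
  set C₂ : ℝ × ℝ → ℝ := fun p => lineConst k g (τ p) with hC₂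
  have hchain : ∀ f : ℝ × ℝ → ℝ, ∀ p ∈ ψ.target, DifferentiableAt ℝ f (τ p) →
      DifferentiableAt ℝ (fun p => f (τ p)) p ∧
      fderiv ℝ (fun p => f (τ p)) p (1, 0) = fderiv ℝ f (τ p) (fderiv ℝ τ p (1, 0)) := by
    intro f p hp hf
    refine ⟨hf.comp p (hτd p hp), ?_⟩
    have := fderiv_comp p hf (hτd p hp)
    exact congrArg (fun L : (ℝ × ℝ) →L[ℝ] ℝ => L (1, 0)) this
  -- `position` grows at unit rate along `∂_x`, so `C₁` has zero `x`-derivative; on a square it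
  -- therefore depends on `y` alone. The same argument applies to `C₂`, and the values on the
  -- vertical line through the centre define `c₁` and `c₂`.
  have hC₁c : ∀ p ∈ ψ.target, C₁ p = C₁ (p₀.1, p.2) := by
    rw [hψt]
    intro p hp
    refine eq_of_dx_eq_zero (fun p' hp' => ?_) hp
    rw [← hψt] at hp'
    obtain ⟨-, h0, hω, -⟩ := hNg _ (hτN p' hp')
    obtain ⟨d, e⟩ := hchain _ p' hp' (H.contDiffAt_position (hτt p' hp') h0 hω).diff
    refine ⟨d.fun_sub differentiableAt_fst, ?_⟩
    rw [H.fderiv_position (hτt p' hp') h0 hω (hvec p' hp').1 (hvec p' hp').2] at e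
    have := dx_sub d (differentiableAt_fst (𝕜 := ℝ) (p := p'))
    refine this.trans ?_
    simp only [dx]
    rw [e, fderiv_fst]
    simp
  have hC₂c : ∀ p ∈ ψ.target, C₂ p = C₂ (p₀.1, p.2) := by
    rw [hψt]
    intro p hp
    refine eq_of_dx_eq_zero (fun p' hp' => ?_) hp
    rw [← hψt] at hp'
    obtain ⟨-, h0, hω, -⟩ := hNg _ (hτN p' hp')
    obtain ⟨d, e⟩ := hchain _ p' hp' (H.contDiffAt_lineConst (hτt p' hp') h0 hω).diff
    refine ⟨d, ?_⟩
    rw [H.fderiv_lineConst (hτt p' hp') h0 hω (hvec p' hp').1 (hvec p' hp').2] at e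
    exact e
  have hform : ∀ p ∈ ψ.target, p.1 + C₁ (p₀.1, p.2) = position k g (τ p) ∧
      C₂ (p₀.1, p.2) = lineConst k g (τ p) := by
    intro p hp
    rw [← hC₁c p hp, ← hC₂c p hp]
    exact ⟨by simp [hC₁], rfl⟩
  have hpos : ∀ p ∈ ψ.target, position k g (τ p) ≠ 0 := by
    intro p hp
    exact neg_ne_zero.2 (div_ne_zero (speed_pos k g _).ne' (hNg _ (hτN p hp)).2.2.1)
  -- The denominator is `-w² ω g`, and `w ω = -speed`; dividing `w` by it gives `α = 1 / (speed ·
  -- g)`.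
  have hden : ∀ p ∈ ψ.target, (p.1 + C₁ (p₀.1, p.2)) ^ 2 + C₂ (p₀.1, p.2)
      = position k g (τ p) * (speed k g (τ p) * g (τ p)) := by
    intro p hp
    rw [(hform p hp).1, (hform p hp).2]
    have hω : spread k g (τ p) ≠ 0 := (hNg _ (hτN p hp)).2.2.1
    simp only [lineConst, position]
    field_simp
    ring
  have hsymm : ∀ p ∈ ψ.target, φ.symm (τ p) = ψ.symm p := fun p hp =>
    φ.left_inv (hNg _ (hτN p hp)).1
  refine ⟨ψ, fun t => C₁ (p₀.1, t), fun t => C₂ (p₀.1, t), hqψ, hψN, ⟨?_, ?_, ?_⟩, hform⟩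
  · intro p hp
    obtain ⟨-, h0, hω, h1⟩ := hNg _ (hτN p hp)
    simp only [(hform p hp).2, lineConst]
    refine mul_ne_zero (mul_ne_zero (hpos p hp) (hpos p hp)) fun h => h1 ?_
    change spread k g (τ p) * g (τ p) = -1
    linear_combination -h
  · intro p hp
    simp only [hden p hp]
    exact mul_ne_zero (hpos p hp) (mul_ne_zero (speed_pos k g _).ne' (hNg _ (hτN p hp)).2.1)
  · refine ⟨fun p => IsGraphChart.frame c s u (τ p), ⟨hψmem, fun p _ => hφ.isUnit₂_frame _, ?_⟩, ?_⟩
    · intro p hp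
      obtain ⟨-, h0, hω, -⟩ := hNg _ (hτN p hp)
      have hev : X ∘ ψ.symm =ᶠ[𝓝 p] (X ∘ φ.symm) ∘ τ := by
        filter_upwards [ψ.open_target.mem_nhds hp] with p' hp'
        simp [hsymm p' hp']
      have hXφ : DifferentiableAt ℝ (X ∘ φ.symm) (τ p) :=
        (contDiffAt_comp_symm hφ.smooth_chart (hτt p hp) (hX.smooth _)).differentiableAt (by simp)
      rw [hev.fderiv_eq, fderiv_comp p hXφ (hτd p hp), ContinuousLinearMap.comp_apply,
        ← hsymm p hp, hφ.horizontal_frame hX (hτt p hp) h0]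
      obtain ⟨e2, e1⟩ := hvec p hp
      have hsp : speed k g (τ p) ≠ 0 := (speed_pos k g _).ne'
      have e1' : (fderiv ℝ τ p (1, 0)).1 = 1 / speed k g (τ p) := by
        rw [eq_div_iff hsp]; exact e1
      congr 1
      refine Prod.ext e1' ?_
      rw [e2, e1']
      simp only [speed, hk, hg]
      ring
    · intro p hp
      obtain ⟨-, h0, hω, -⟩ := hNg _ (hτN p hp)
      have hα := hφ.alpha_mem_tangentPlane hX (hτt p hp) h0
      rw [hsymm p hp] at hα
      have he : (p.1 + C₁ (p₀.1, p.2)) / ((p.1 + C₁ (p₀.1, p.2)) ^ 2 + C₂ (p₀.1, p.2))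
          = 1 / (speed k g (τ p) * g (τ p)) := by
        rw [hden p hp, (hform p hp).1]
        have := hpos p hp
        have h3 : g (τ p) ≠ 0 := h0
        have h4 := (speed_pos k g (τ p)).ne'
        field_simp
      simp only [he]
      exact hα

end Charts

/-! ### Types at regular points, and graph charts at singular points -/

section Charts

variable {M : Type*} [TopologicalSpace M] [ChartedSpace (ℝ × ℝ) M]
  [IsManifold 𝓘(ℝ, ℝ × ℝ) ∞ M] {X : M → H1}
  {φ : OpenPartialHomeomorph M (ℝ × ℝ)} {c s : ℝ} {u : ℝ × ℝ → ℝ}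

theorem position_sq_add_lineConst (k g : ℝ × ℝ → ℝ) (p : ℝ × ℝ) :
    position k g p ^ 2 + lineConst k g p = position k g p ^ 2 * -(spread k g p * g p) := by
  simp only [lineConst]; ring

theorem position_sq_pos {k g : ℝ × ℝ → ℝ} {p : ℝ × ℝ} (hω : spread k g p ≠ 0) :
    0 < position k g p ^ 2 := by
  have : position k g p ≠ 0 := neg_ne_zero.2 (div_ne_zero (speed_pos k g p).ne' hω)
  positivity

/-- Regular points where `-1 < ω g < 0` are of type II. -/
theorem IsGraphChart.exists_typeII_chart (hφ : IsGraphChart X φ c s u) (hX : IsImmersedSurface X)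
    (H : IsPMinimalForm φ.target (formK u) (formG u)) {q : M} (hq : q ∈ φ.source)
    {O : Set M} (hO : IsOpen O) (hqO : q ∈ O) (h0 : formG u (φ q) ≠ 0)
    (h1 : -1 < spread (formK u) (formG u) (φ q) * formG u (φ q))
    (h2 : spread (formK u) (formG u) (φ q) * formG u (φ q) < 0) :
    ∃ (ψ : OpenPartialHomeomorph M (ℝ × ℝ)) (c₁ c₂ : ℝ → ℝ),
      q ∈ ψ.source ∧ ψ.source ⊆ O ∧ IsGeneralChart X ψ c₁ c₂ ∧
      (∀ p ∈ ψ.target, c₂ p.2 < 0) ∧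
      ((∀ p ∈ ψ.target, p.1 < -c₁ p.2 - √(-c₂ p.2)) ∨
        (∀ p ∈ ψ.target, -c₁ p.2 + √(-c₂ p.2) < p.1)) := by
  set k := formK u
  set g := formG u
  have hz := φ.map_source hq
  have hω0 : spread k g (φ q) ≠ 0 := by
    intro h; rw [h] at h2; simp at h2
  -- Fixing the sign of `ω` fixes the sign of `w = -speed / ω`, hence which of the two half-lines of
  -- type II occurs throughout the chart.
  have hloc : ∀ᶠ z in 𝓝 (φ q), g z ≠ 0 ∧ 0 < spread k g z * spread k g (φ q) ∧
      -1 < spread k g z * g z ∧ spread k g z * g z < 0 := by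
    have cg := (H.smooth_g _ hz).continuousAt
    have cω := (H.contDiffAt_spread hz h0).continuousAt
    exact (cg.eventually_ne h0).and (((cω.mul continuousAt_const).eventually_const_lt
      (mul_self_pos.2 hω0)).and (((cω.mul cg).eventually_const_lt h1).and
      ((cω.mul cg).eventually_lt_const h2)))
  obtain ⟨A, hA, hAo, hqA⟩ := eventually_nhds_iff.1 hloc
  obtain ⟨ψ, c₁, c₂, hqψ, hsub, hgen, hform⟩ := hφ.exists_generalChart hX H hq
    (N := O ∩ (φ.source ∩ φ ⁻¹' A)) (hO.inter (φ.isOpen_inter_preimage hAo)) ⟨hqO, hq, hqA⟩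
    (fun x hx => by
      obtain ⟨a1, a2, a3, a4⟩ := hA _ hx.2.2
      exact ⟨hx.2.1, a1, left_ne_zero_of_mul a2.ne', a3.ne'⟩)
  have hmem : ∀ p ∈ ψ.target, φ (ψ.symm p) ∈ A := fun p hp => (hsub (ψ.map_target hp)).2.2
  have key : ∀ p ∈ ψ.target, c₂ p.2 < 0 ∧ √(-c₂ p.2) < |p.1 + c₁ p.2| := by
    intro p hp
    obtain ⟨a1, a2, a3, a4⟩ := hA _ (hmem p hp)
    obtain ⟨f1, f2⟩ := hform p hp
    have hpos := position_sq_pos (k := k) (g := g) (left_ne_zero_of_mul a2.ne')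
    have hid := position_sq_add_lineConst k g (φ (ψ.symm p))
    rw [f1, f2]
    constructor
    · nlinarith
    · rw [← Real.sqrt_sq_eq_abs]
      exact Real.sqrt_lt_sqrt (by nlinarith) (by nlinarith)
  refine ⟨ψ, c₁, c₂, hqψ, hsub.trans inter_subset_left, hgen, fun p hp => (key p hp).1, ?_⟩
  rcases lt_or_gt_of_ne hω0 with hneg | hpos
  · right
    intro p hp
    obtain ⟨a1, a2, a3, a4⟩ := hA _ (hmem p hp)
    have hω : spread k g (φ (ψ.symm p)) < 0 := by nlinarith
    have hw : 0 < p.1 + c₁ p.2 := by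
      rw [(hform p hp).1, position, neg_pos]
      exact div_neg_of_pos_of_neg (speed_pos _ _ _) hω
    have := (key p hp).2
    rw [abs_of_pos hw] at this
    linarith
  · left
    intro p hp
    obtain ⟨a1, a2, a3, a4⟩ := hA _ (hmem p hp)
    have hω : 0 < spread k g (φ (ψ.symm p)) := pos_of_mul_pos_left a2 hpos.le
    have hw : p.1 + c₁ p.2 < 0 := by
      rw [(hform p hp).1, position, neg_lt_zero]
      exact div_pos (speed_pos _ _ _) hω
    have := (key p hp).2
    rw [abs_of_neg hw] at this
    linarith

/-- Regular points where `0 < ω g` are of type III. -/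
theorem IsGraphChart.exists_typeIII_chart (hφ : IsGraphChart X φ c s u) (hX : IsImmersedSurface X)
    (H : IsPMinimalForm φ.target (formK u) (formG u)) {q : M} (hq : q ∈ φ.source)
    {O : Set M} (hO : IsOpen O) (hqO : q ∈ O) (h0 : formG u (φ q) ≠ 0)
    (h1 : 0 < spread (formK u) (formG u) (φ q) * formG u (φ q)) :
    ∃ (ψ : OpenPartialHomeomorph M (ℝ × ℝ)) (c₁ c₂ : ℝ → ℝ),
      q ∈ ψ.source ∧ ψ.source ⊆ O ∧ IsGeneralChart X ψ c₁ c₂ ∧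
      (∀ p ∈ ψ.target, c₂ p.2 < 0) ∧
      (∀ p ∈ ψ.target, -c₁ p.2 - √(-c₂ p.2) < p.1 ∧ p.1 < -c₁ p.2 + √(-c₂ p.2)) := by
  set k := formK u
  set g := formG u
  have hz := φ.map_source hq
  have hloc : ∀ᶠ z in 𝓝 (φ q), g z ≠ 0 ∧ 0 < spread k g z * g z := by
    have cg := (H.smooth_g _ hz).continuousAt
    have cω := (H.contDiffAt_spread hz h0).continuousAt
    exact (cg.eventually_ne h0).and ((cω.mul cg).eventually_const_lt h1)
  obtain ⟨A, hA, hAo, hqA⟩ := eventually_nhds_iff.1 hloc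
  obtain ⟨ψ, c₁, c₂, hqψ, hsub, hgen, hform⟩ := hφ.exists_generalChart hX H hq
    (N := O ∩ (φ.source ∩ φ ⁻¹' A)) (hO.inter (φ.isOpen_inter_preimage hAo)) ⟨hqO, hq, hqA⟩
    (fun x hx => by
      obtain ⟨a1, a2⟩ := hA _ hx.2.2
      exact ⟨hx.2.1, a1, left_ne_zero_of_mul a2.ne', by linarith⟩)
  have hmem : ∀ p ∈ ψ.target, φ (ψ.symm p) ∈ A := fun p hp => (hsub (ψ.map_target hp)).2.2
  have key : ∀ p ∈ ψ.target, c₂ p.2 < 0 ∧ |p.1 + c₁ p.2| < √(-c₂ p.2) := by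
    intro p hp
    obtain ⟨a1, a2⟩ := hA _ (hmem p hp)
    obtain ⟨f1, f2⟩ := hform p hp
    have hpos := position_sq_pos (k := k) (g := g) (left_ne_zero_of_mul a2.ne')
    have hid := position_sq_add_lineConst k g (φ (ψ.symm p))
    rw [f1, f2]
    constructor
    · nlinarith
    · rw [← Real.sqrt_sq_eq_abs]
      exact Real.sqrt_lt_sqrt hpos.le (by nlinarith)
  refine ⟨ψ, c₁, c₂, hqψ, hsub.trans inter_subset_left, hgen, fun p hp => (key p hp).1, ?_⟩
  intro p hp
  have := abs_lt.1 (key p hp).2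
  constructor <;> linarith [this.1, this.2]

/-- The contact plane projects isomorphically to the `xy`-plane, so `x, y` are coordinates near a
singular point. There `g_x = 1 + u_xy`; a rotation by a right angle changes the sign of `u_xy`, so
one of the two charts has `g_x > 0`. -/
theorem exists_graphChart (hX : IsImmersedSurface X) {q : M} (hq : IsSingularPoint X q) :
    ∃ (φ : OpenPartialHomeomorph M (ℝ × ℝ)) (c s : ℝ) (u : ℝ × ℝ → ℝ),
      IsGraphChart X φ c s u ∧ q ∈ φ.source ∧ 0 < dx (formG u) (φ q) := by
  set χ := chartAt (ℝ × ℝ) q with hχ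
  have hχm : χ ∈ IsManifold.maximalAtlas 𝓘(ℝ, ℝ × ℝ) ∞ M :=
    IsManifold.chart_mem_maximalAtlas q
  have hqχ : q ∈ χ.source := mem_chart_source _ q
  have hsm : ∀ p ∈ χ.target, ContDiffAt ℝ ∞ (X ∘ χ.symm) p := fun p hp =>
    contDiffAt_comp_symm hχm hp (hX.smooth _)
  set π : H1 →L[ℝ] (ℝ × ℝ) := (ContinuousLinearMap.fst ℝ ℝ (ℝ × ℝ)).prod
    ((ContinuousLinearMap.fst ℝ ℝ ℝ).comp (ContinuousLinearMap.snd ℝ ℝ (ℝ × ℝ))) with hπ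
  have hπe : ∀ w : H1, π w = (w.1, w.2.1) := fun w => rfl
  have hqt : χ q ∈ χ.target := χ.map_source hqχ
  have hder : fderiv ℝ (π ∘ (X ∘ χ.symm)) (χ q) = π.comp (fderiv ℝ (X ∘ χ.symm) (χ q)) := by
    have := fderiv_comp (χ q) π.differentiableAt ((hsm _ hqt).differentiableAt (by simp))
    rwa [ContinuousLinearMap.fderiv] at this
  have hsurj : Function.Surjective (fderiv ℝ (π ∘ (X ∘ χ.symm)) (χ q)) := by
    intro w
    have hmem : horizontal (X q) w ∈ tangentPlane X q := by
      rw [hq]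
      exact contactForm_horizontal _ _
    have hsq : χ.symm (χ q) = q := χ.left_inv hqχ
    rw [← hsq, tangentPlane_symm hX hχm hqt] at hmem
    obtain ⟨v, hv⟩ := hmem
    refine ⟨v, ?_⟩
    rw [hder, ContinuousLinearMap.comp_apply, hv]
    rfl
  have hinj : Function.Injective (fderiv ℝ (π ∘ (X ∘ χ.symm)) (χ q)) :=
    (LinearMap.injective_iff_surjective
      (f := (fderiv ℝ (π ∘ (X ∘ χ.symm)) (χ q)).toLinearMap)).2 hsurj
  obtain ⟨φ, hφm, hqφ, hsub, hφe⟩ := exists_chart_comp hχm (f := π ∘ (X ∘ χ.symm)) hqχ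
    (by filter_upwards [χ.open_target.mem_nhds hqt] with p hp
        exact π.contDiff.contDiffAt.comp p (hsm p hp)) hinj
  have hφX : ∀ x ∈ φ.source, φ x = ((X x).1, (X x).2.1) := by
    intro x hx
    rw [hφe x hx]
    simp only [Function.comp_apply, χ.left_inv (hsub hx), hπe]
  set u : ℝ × ℝ → ℝ := fun p => (X (φ.symm p)).2.2 with hu
  have hgraph : IsGraphChart X φ 1 0 u := by
    refine ⟨hφm, by norm_num, fun p hp => ?_⟩
    have := hφX _ (φ.map_target hp)
    rw [φ.right_inv hp] at this
    have e1 := congrArg Prod.fst this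
    have e2 := congrArg Prod.snd this
    simp only at e1 e2
    refine Prod.ext ?_ (Prod.ext ?_ rfl)
    · simp [e1]
    · simp [e2]
  have hzt := φ.map_source hqφ
  have hud := hgraph.contDiffAt_u hX hzt
  by_cases hpos : 0 < dx (formG u) (φ q)
  · exact ⟨φ, 1, 0, u, hgraph, hqφ, hpos⟩
  -- otherwise rotate by a right angle
  set ρ : (ℝ × ℝ) →L[ℝ] (ℝ × ℝ) :=
    (ContinuousLinearMap.snd ℝ ℝ ℝ).prod (-ContinuousLinearMap.fst ℝ ℝ ℝ) with hρ
  have hρe : ∀ w : ℝ × ℝ, ρ w = (w.2, -w.1) := fun w => rfl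
  obtain ⟨φ', hφ'm, hqφ', hsub', hφ'e⟩ := exists_chart_comp hφm (f := ρ) hqφ
    (Eventually.of_forall fun p => ρ.contDiff.contDiffAt) (by
      rw [ContinuousLinearMap.fderiv]
      intro v w hvw
      rw [hρe, hρe, Prod.mk.injEq] at hvw
      exact Prod.ext (neg_injective hvw.2) hvw.1)
  set r : (ℝ × ℝ) →L[ℝ] (ℝ × ℝ) :=
    (-ContinuousLinearMap.snd ℝ ℝ ℝ).prod (ContinuousLinearMap.fst ℝ ℝ ℝ) with hr
  have hre : ∀ w : ℝ × ℝ, r w = (-w.2, w.1) := fun w => rfl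
  have hφ'r : ∀ p ∈ φ'.target, r p ∈ φ.target ∧ φ'.symm p = φ.symm (r p) := by
    intro p hp
    have h1 := φ'.map_target hp
    have h2 := hφ'e _ h1
    rw [φ'.right_inv hp] at h2
    have h3 : r p = φ (φ'.symm p) := 
      (congrArg r h2).trans (by rw [hρe, hre]; simp)
    rw [h3]
    exact ⟨φ.map_source (hsub' h1), (φ.left_inv (hsub' h1)).symm⟩
  have hgraph' : IsGraphChart X φ' 0 1 (u ∘ r) := by
    refine ⟨hφ'm, by norm_num, fun p hp => ?_⟩
    obtain ⟨h1, h2⟩ := hφ'r p hp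
    rw [h2, hgraph.eq _ h1, hre]
    simp [hre]
  refine ⟨φ', 0, 1, u ∘ r, hgraph', hqφ', ?_⟩
  have hz't := φ'.map_source hqφ'
  have hrz : r (φ' q) = φ q := by
    rw [hφ'e q hqφ', hρe, hre]; simp
  have hcomp : ∀ f : ℝ × ℝ → ℝ, ∀ p, DifferentiableAt ℝ f (r p) → ∀ v,
      fderiv ℝ (f ∘ r) p v = fderiv ℝ f (r p) (r v) := by
    intro f p hf v
    rw [fderiv_comp p hf r.differentiableAt, ContinuousLinearMap.fderiv]
    rfl
  have hdy : dy (u ∘ r) =ᶠ[𝓝 (φ' q)] fun p => 0 - (dx u ∘ r) p := by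
    filter_upwards [φ'.open_target.mem_nhds hz't] with p hp
    have := hcomp u p (hgraph.contDiffAt_u hX (hφ'r p hp).1).diff (0, 1)
    rw [fderiv_apply_eq u, hre] at this
    simpa [dy, dx] using this
  have hdd : dx (dy (u ∘ r)) (φ' q) = -dy (dx u) (φ q) := by
    have hdu := (contDiffAt_dx hud).diff
    rw [← hrz] at hdu
    rw [dx_congr hdy, dx_sub (differentiableAt_const _) (hdu.comp _ r.differentiableAt)]
    have := hcomp (dx u) (φ' q) hdu (1, 0)
    rw [fderiv_apply_eq (dx u), hre, hrz] at this
    simp only [dx] at this ⊢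
    simp [this]
  rw [dx_formG (hgraph'.contDiffAt_u hX hz't), hdd]
  rw [dx_formG hud, dx_dy_comm hud] at hpos
  linarith

end Charts

/-! ### The singular curve in a graph chart -/

theorem mul_pos_of_ne_zero_on_uIcc {f : ℝ → ℝ} {a b : ℝ} (hf : ContinuousOn f (uIcc a b))
    (h0 : ∀ t ∈ uIcc a b, f t ≠ 0) : 0 < f a * f b := by
  by_contra hcon
  have h : (0 : ℝ) ∈ uIcc (f a) (f b) := by
    rw [mem_uIcc]
    rcases mul_nonpos_iff.1 (not_lt.1 hcon) with h | h
    · exact Or.inr ⟨h.2, h.1⟩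
    · exact Or.inl h
  obtain ⟨t, ht, he⟩ := intermediate_value_uIcc hf h
  exact h0 t ht he

section Curve

variable {M : Type*} [TopologicalSpace M] {φ : OpenPartialHomeomorph M (ℝ × ℝ)}
  {Γ S S' : Set M}

/-- The image of `Γ` in the chart `φ`. -/
def chartImage (φ : OpenPartialHomeomorph M (ℝ × ℝ)) (Γ : Set M) : Set (ℝ × ℝ) :=
  {p | p ∈ φ.target ∧ φ.symm p ∈ Γ}

/-- A local parametrization of the curve `Γ`. -/
theorem exists_param (hsides : IsCurveWithSides Γ S S') {p : ℝ × ℝ} (hp : p ∈ chartImage φ Γ) :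
    ∃ δ > 0, ∃ γ : ℝ → ℝ × ℝ, ContinuousOn γ (Metric.ball 0 δ) ∧ InjOn γ (Metric.ball 0 δ) ∧
      γ 0 = p ∧ ∀ t ∈ Metric.ball (0 : ℝ) δ, γ t ∈ chartImage φ Γ := by
  obtain ⟨ψ, hqψ, hψ⟩ := hsides _ hp.2
  set q := φ.symm p with hq
  have hq2 : (ψ q).2 = 0 := (hψ q hqψ).1.1 hp.2
  set ℓ : ℝ → ℝ × ℝ := fun t => ((ψ q).1 + t, 0) with hℓ
  have hℓc : Continuous ℓ := by fun_prop
  have hℓ0 : ℓ 0 = ψ q := Prod.ext (by simp [hℓ]) (by simp [hℓ, hq2])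
  have hT : IsOpen (ψ.target ∩ ψ.symm ⁻¹' φ.source) :=
    ψ.symm.isOpen_inter_preimage φ.open_source
  have hmem : ℓ 0 ∈ ψ.target ∩ ψ.symm ⁻¹' φ.source := by
    rw [hℓ0]
    refine ⟨ψ.map_source hqψ, ?_⟩
    rw [mem_preimage, ψ.left_inv hqψ]
    exact φ.map_target hp.1
  obtain ⟨δ, hδ, hball⟩ := Metric.isOpen_iff.1 (hT.preimage hℓc) 0 hmem
  refine ⟨δ, hδ, fun t => φ (ψ.symm (ℓ t)), ?_, ?_, ?_, ?_⟩
  · intro t ht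
    obtain ⟨h1, h2⟩ := hball ht
    have c1 : ContinuousAt (fun t => ψ.symm (ℓ t)) t :=
      ContinuousAt.comp (f := ℓ) (g := ψ.symm) (ψ.symm.continuousAt h1) hℓc.continuousAt
    exact (ContinuousAt.comp (f := fun t => ψ.symm (ℓ t)) (g := φ) (φ.continuousAt h2)
      c1).continuousWithinAt
  · intro t ht t' ht' he
    obtain ⟨h1, h2⟩ := hball ht
    obtain ⟨h1', h2'⟩ := hball ht'
    have := ψ.symm.injOn h1 h1' (φ.injOn h2 h2' he)
    simpa [hℓ] using this
  · simp only
    rw [hℓ0, ψ.left_inv hqψ, φ.right_inv hp.1]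
  · intro t ht
    obtain ⟨h1, h2⟩ := hball ht
    refine ⟨φ.map_source h2, ?_⟩
    rw [φ.left_inv h2, (hψ _ (ψ.map_target h1)).1, ψ.right_inv h1]

/-- An injective continuous arc accumulates at each of its points. This is what forces `dk` and `dg`
to be dependent on `Γ`. -/
theorem frequently_mem_chartImage (hsides : IsCurveWithSides Γ S S') {p : ℝ × ℝ}
    (hp : p ∈ chartImage φ Γ) : ∃ᶠ z in 𝓝[≠] p, z ∈ chartImage φ Γ := by
  obtain ⟨δ, hδ, γ, hc, hi, h0, hm⟩ := exists_param hsides hp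
  have hball := Metric.ball_mem_nhds (0 : ℝ) hδ
  have ht : Tendsto γ (𝓝[≠] 0) (𝓝[≠] p) := by
    rw [tendsto_nhdsWithin_iff]
    constructor
    · have := (hc.continuousAt hball).tendsto
      rw [h0] at this
      exact this.mono_left nhdsWithin_le_nhds
    · filter_upwards [mem_nhdsWithin_of_mem_nhds hball, self_mem_nhdsWithin] with t ht ht0 he
      exact ht0 (hi ht (Metric.mem_ball_self hδ) (he.trans h0.symm))
  intro hcon
  have h1 := ht.eventually hcon
  have h2 : ∀ᶠ t in 𝓝[≠] (0 : ℝ), γ t ∈ chartImage φ Γ := by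
    filter_upwards [mem_nhdsWithin_of_mem_nhds hball] with t ht using hm t ht
  obtain ⟨t, ht1, ht2⟩ := (h1.and h2).exists
  exact ht1 ht2

/-- As `g` is strictly increasing on horizontal lines and zero on `Γ`, each such line meets `Γ` at
most once near `p₀`. So the height is injective along the arc, hence strictly monotone, and its
values fill a neighbourhood of the height of `p₀`. Only continuity of the arc is used. -/
theorem eventually_exists_slice (hsides : IsCurveWithSides Γ S S') {p₀ : ℝ × ℝ}
    (hp : p₀ ∈ chartImage φ Γ) {g : ℝ × ℝ → ℝ} (hg : ContDiffAt ℝ ∞ g p₀) (hpos : 0 < dx g p₀)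
    (hg0 : ∀ p ∈ chartImage φ Γ, g p = 0) (hsm : ∀ᶠ p in 𝓝 p₀, ContDiffAt ℝ ∞ g p) {a : ℝ}
    (ha : 0 < a) : ∀ᶠ q in 𝓝 p₀, ∃ ξ, |ξ - p₀.1| < a ∧ (ξ, q.2) ∈ chartImage φ Γ := by
  have hev : ∀ᶠ p in 𝓝 p₀, ContDiffAt ℝ ∞ g p ∧ 0 < dx g p :=
    hsm.and ((contDiffAt_dx hg).continuousAt.eventually_const_lt hpos)
  obtain ⟨r, hr, hr0, hra⟩ :=
    ((eventually_forall_ball hev).and (Ioo_mem_nhdsGT ha)).exists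
  obtain ⟨δ, hδ, γ, hc, hi, h0, hm⟩ := exists_param hsides hp
  have hγ0 : ∀ᶠ t in 𝓝 (0 : ℝ), γ t ∈ Metric.ball p₀ r ∧ t ∈ Metric.ball (0 : ℝ) δ := by
    have h1 := (hc.continuousAt (Metric.ball_mem_nhds (0 : ℝ) hδ)).tendsto
    rw [h0] at h1
    exact (h1.eventually (Metric.ball_mem_nhds p₀ hr0)).and (Metric.ball_mem_nhds 0 hδ)
  obtain ⟨δ₁, hδ₁, hb⟩ := Metric.eventually_nhds_iff.1 hγ0
  set d := δ₁ / 2 with hd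
  have hdpos : 0 < d := by positivity
  have hI : ∀ t ∈ Icc (-d) d, γ t ∈ Metric.ball p₀ r ∧ t ∈ Metric.ball (0 : ℝ) δ := by
    intro t ht
    apply hb
    rw [Real.dist_eq, sub_zero, abs_lt]
    constructor <;> linarith [ht.1, ht.2]
  have hyc : ContinuousOn (fun t => (γ t).2) (Icc (-d) d) :=
    continuous_snd.comp_continuousOn (hc.mono fun t ht => (hI t ht).2)
  have hyi : InjOn (fun t => (γ t).2) (Icc (-d) d) := by
    intro t ht t' ht' he
    obtain ⟨b1, b2⟩ := hI t ht
    obtain ⟨b1', b2'⟩ := hI t' ht'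
    apply hi b2 b2'
    have z1 := hg0 _ (hm t b2)
    have z2 := hg0 _ (hm t' b2')
    obtain ⟨m1, m2⟩ := mem_ball_prod.1 b1
    obtain ⟨m1', m2'⟩ := mem_ball_prod.1 b1'
    have he' : (γ t).2 = (γ t').2 := he
    refine Prod.ext ?_ he'
    rcases lt_trichotomy (γ t).1 (γ t').1 with h | h | h
    · have := lt_of_dx_pos_on_slice hr m1 m1' m2 h
      rw [he'] at this
      change g ((γ t).1, (γ t').2) < g (γ t') at this
      rw [← he'] at this
      change g (γ t) < g (γ t') at this
      linarith
    · exact h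
    · have := lt_of_dx_pos_on_slice hr m1' m1 m2 h
      change _ < g (γ t) at this
      rw [he'] at this
      change g (γ t') < g (γ t) at this
      linarith
  have hsub : (γ 0).2 = p₀.2 := by rw [h0]
  have mem0 : (0 : ℝ) ∈ Icc (-d) d := ⟨by linarith, hdpos.le⟩
  have meml : -d ∈ Icc (-d) d := ⟨le_rfl, by linarith⟩
  have memr : d ∈ Icc (-d) d := ⟨by linarith, le_rfl⟩
  have hfin : ∀ y ∈ (fun t => (γ t).2) '' Icc (-d) d, ∃ ξ, |ξ - p₀.1| < a ∧
      (ξ, y) ∈ chartImage φ Γ := by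
    rintro y ⟨t, ht, rfl⟩
    exact ⟨(γ t).1, (mem_ball_prod.1 (hI t ht).1).1.trans hra, hm t (hI t ht).2⟩
  have hsnd : Tendsto (fun q : ℝ × ℝ => q.2) (𝓝 p₀) (𝓝 p₀.2) := continuous_snd.tendsto p₀
  rcases ContinuousOn.strictMonoOn_of_injOn_Icc' (by linarith) hyc hyi with hmono | hanti
  · have l := hmono meml mem0 (by linarith)
    have r := hmono mem0 memr hdpos
    simp only [hsub] at l r
    filter_upwards [hsnd.eventually (Ioo_mem_nhds l r)] with q hq
    exact hfin _ (intermediate_value_Icc (by linarith) hyc (Ioo_subset_Icc_self hq))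
  · have l := hanti meml mem0 (by linarith)
    have r := hanti mem0 memr hdpos
    simp only [hsub] at l r
    filter_upwards [hsnd.eventually (Ioo_mem_nhds r l)] with q hq
    exact hfin _ (intermediate_value_Icc' (by linarith) hyc (Ioo_subset_Icc_self hq))

/-- Non-isolated common zeros are degenerate. -/
theorem det_eq_zero_of_frequently {k g : ℝ × ℝ → ℝ} {p : ℝ × ℝ} (hk : DifferentiableAt ℝ k p)
    (hg : DifferentiableAt ℝ g p) (h : ∃ᶠ z in 𝓝[≠] p, k z = 0 ∧ g z = 0) :
    dx k p * dy g p = dy k p * dx g p := by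
  by_contra hne
  apply h
  have hd := hk.hasFDerivAt.prodMk hg.hasFDerivAt
  have hinj : LinearMap.ker ((fderiv ℝ k p).prod (fderiv ℝ g p)).toLinearMap = ⊥ := by
    rw [LinearMap.ker_eq_bot']
    intro v hv
    have h1 : fderiv ℝ k p v = 0 := congrArg Prod.fst hv
    have h2 : fderiv ℝ g p v = 0 := congrArg Prod.snd hv
    rw [fderiv_apply_eq] at h1 h2
    have hne' := sub_ne_zero.2 hne
    refine Prod.ext ?_ ?_
    · apply (mul_eq_zero.1 (show (dx k p * dy g p - dy k p * dx g p) * v.1 = 0 by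
        linear_combination dy g p * h1 - dy k p * h2)).resolve_left hne'
    · apply (mul_eq_zero.1 (show (dx k p * dy g p - dy k p * dx g p) * v.2 = 0 by
        linear_combination dx k p * h2 - dx g p * h1)).resolve_left hne'
  -- An injective derivative is bounded below, so `(k, g)` takes the value `(0, 0)` at no other
  -- point near `p`.
  obtain ⟨K, -, hK⟩ := LinearMap.exists_antilipschitzWith _ hinj
  filter_upwards [hd.eventually_ne (c := (0, 0)) ⟨K, hK⟩] with z hz hcon
  exact hz (Prod.ext hcon.1 hcon.2)

end Curve

/-! ### The sign of `g` on the two sides of the singular curve -/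

section Crossing

variable {M : Type*} [TopologicalSpace M] {φ : OpenPartialHomeomorph M (ℝ × ℝ)} {Γ S S' : Set M}

theorem IsGraphChart.isSingularCurveAt [ChartedSpace (ℝ × ℝ) M] {X : M → H1} {c s : ℝ}
    {u : ℝ × ℝ → ℝ} (hφ : IsGraphChart X φ c s u) (hX : IsImmersedSurface X)
    (hsing : ∀ q ∈ Γ, IsSingularPoint X q) (hsides : IsCurveWithSides Γ S S') {p₀ : ℝ × ℝ}
    (hp : p₀ ∈ chartImage φ Γ) (hpos : 0 < dx (formG u) p₀) :
    IsSingularCurveAt (chartImage φ Γ) (formK u) (formG u) p₀ := by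
  have hz : ∀ p ∈ chartImage φ Γ, formK u p = 0 ∧ formG u p = 0 := fun p hp =>
    hφ.form_eq_zero hX hp.1 (hsing _ hp.2)
  refine ⟨hp, fun p hp => (hz p hp).1, fun p hp => (hz p hp).2, fun p hp => ?_, hpos,
    fun a ha => ?_⟩
  · have hu := hφ.contDiffAt_u hX hp.1
    exact det_eq_zero_of_frequently (contDiffAt_formK hu).diff (contDiffAt_formG hu).diff
      ((frequently_mem_chartImage hsides hp).mono hz)
  · refine eventually_exists_slice hsides hp (contDiffAt_formG (hφ.contDiffAt_u hX hp.1)) hpos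
      (fun p hp => (hz p hp).2) ?_ ha
    filter_upwards [φ.open_target.mem_nhds hp.1] with p hp
    exact contDiffAt_formG (hφ.contDiffAt_u hX hp)

/-- The two sides of the singular curve are distinguished by the sign of `g`. -/
theorem IsSingularCurveAt.exists_sign {k g : ℝ × ℝ → ℝ} {p₀ : ℝ × ℝ}
    (hZ : IsSingularCurveAt (chartImage φ Γ) k g p₀) (hsides : IsCurveWithSides Γ S S')
    (hsm : ∀ p ∈ φ.target, ContDiffAt ℝ ∞ g p) :
    ∃ ε : ℝ, ε ^ 2 = 1 ∧ ∀ᶠ z in 𝓝 p₀, (0 < ε * g z → φ.symm z ∈ S) ∧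
      (φ.symm z ∈ S' → ε * g z < 0) := by
  obtain ⟨hp₀, hΓ⟩ := hZ.mem
  obtain ⟨ψ, hqψ, hψ⟩ := hsides _ hΓ
  set q := φ.symm p₀ with hq
  set V : ℝ × ℝ → ℝ := fun z => (ψ (φ.symm z)).2 with hV
  set T : Set (ℝ × ℝ) := φ.target ∩ φ.symm ⁻¹' ψ.source with hT
  have hTo : IsOpen T := φ.symm.isOpen_inter_preimage ψ.open_source
  have hVc : ∀ z ∈ T, ContinuousAt V z := by
    intro z hz
    have c1 : ContinuousAt (fun z => ψ (φ.symm z)) z :=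
      ContinuousAt.comp (f := φ.symm) (g := ψ) (ψ.continuousAt hz.2) (φ.symm.continuousAt hz.1)
    exact continuous_snd.continuousAt.comp c1
  have hV0 : ∀ z ∈ T, V z = 0 → g z = 0 := fun z hz h =>
    hZ.g_eq_zero _ ⟨hz.1, (hψ _ hz.2).1.2 h⟩
  have hev : ∀ᶠ p in 𝓝 p₀, p ∈ T ∧ ContDiffAt ℝ ∞ g p ∧ 0 < dx g p := by
    refine (show ∀ᶠ p in 𝓝 p₀, p ∈ T from hTo.mem_nhds ⟨hp₀, hqψ⟩).and (Eventually.and ?_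
      ((contDiffAt_dx (hsm p₀ hp₀)).continuousAt.eventually_const_lt hZ.dx_pos))
    filter_upwards [φ.open_target.mem_nhds hp₀] with p hp using hsm p hp
  obtain ⟨r, hr, hr0⟩ :=
    ((eventually_forall_ball hev).and self_mem_nhdsWithin).exists
  have hr0' : (0 : ℝ) < r := hr0
  have hmono := fun {x ξ y : ℝ} (hx : |x - p₀.1| < r) (hξ : |ξ - p₀.1| < r) (hy : |y - p₀.2| < r)
    (hlt : x < ξ) => lt_of_dx_pos_on_slice (g := g) (p₀ := p₀)
      (fun q hq => (hr q hq).2) hx hξ hy hlt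
  obtain ⟨r₂, hr₂, hr₂0, hr₂r⟩ := ((eventually_forall_ball
    (hZ.slices (r / 2) (by positivity))).and (Ioo_mem_nhdsGT hr0')).exists
  have hslice : ∀ y, |y - p₀.2| < r₂ → ∃ ξ, |ξ - p₀.1| < r / 2 ∧ (ξ, y) ∈ chartImage φ Γ := by
    intro y hy
    exact hr₂ (p₀.1, y) (mem_ball_prod.2 ⟨by simpa using hr₂0, hy⟩)
  -- move a point with `g ≠ 0` to the point `(x₀ ± r / 2, y₀)` inside `{g ≠ 0}`
  have hmove : ∀ x₁ : ℝ, |x₁ - p₀.1| < r → ∀ z ∈ Metric.ball p₀ r₂,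
      (∀ t ∈ uIcc z.1 x₁, g (t, z.2) ≠ 0) → (∀ y, |y - p₀.2| < r₂ → g (x₁, y) ≠ 0) →
      0 < V z * V (x₁, p₀.2) := by
    intro x₁ hx₁ z hz hh hv
    obtain ⟨hz1, hz2⟩ := mem_ball_prod.1 hz
    have hmem1 : ∀ t ∈ uIcc z.1 x₁, (t, z.2) ∈ T := by
      intro t ht
      refine (hr (t, z.2) (mem_ball_prod.2 ⟨?_, hz2.trans hr₂r⟩)).1
      have h3 := hz1.trans hr₂r
      rw [abs_lt] at hx₁ h3 ⊢
      rw [mem_uIcc] at ht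
      simp only
      constructor <;> rcases ht with ht | ht <;> linarith [ht.1, ht.2]
    have hmem2 : ∀ y ∈ uIcc z.2 p₀.2, |y - p₀.2| < r₂ := by
      intro y hy
      rw [abs_lt] at hz2 ⊢
      rw [mem_uIcc] at hy
      constructor <;> rcases hy with hy | hy <;> linarith [hy.1, hy.2]
    have hmem2' : ∀ y ∈ uIcc z.2 p₀.2, (x₁, y) ∈ T := fun y hy =>
      (hr _ (mem_ball_prod.2 ⟨hx₁, (hmem2 y hy).trans hr₂r⟩)).1
    have p1 := mul_pos_of_ne_zero_on_uIcc (f := fun t => V (t, z.2)) (a := z.1) (b := x₁)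
      (fun t ht => (ContinuousAt.comp (f := fun t : ℝ => (t, z.2)) (g := V) (hVc _ (hmem1 t ht))
        (by fun_prop)).continuousWithinAt)
      (fun t ht h => hh t ht (hV0 _ (hmem1 t ht) h))
    have p2 := mul_pos_of_ne_zero_on_uIcc (f := fun y => V (x₁, y)) (a := z.2) (b := p₀.2)
      (fun y hy => (ContinuousAt.comp (f := fun y : ℝ => (x₁, y)) (g := V) (hVc _ (hmem2' y hy))
        (by fun_prop)).continuousWithinAt)
      (fun y hy h => hv y (hmem2 y hy) (hV0 _ (hmem2' y hy) h))
    have p3 := mul_pos p1 p2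
    have e : V (z.1, z.2) * V (x₁, z.2) * (V (x₁, z.2) * V (x₁, p₀.2))
        = (V z * V (x₁, p₀.2)) * V (x₁, z.2) ^ 2 := by
      change V z * V (x₁, z.2) * (V (x₁, z.2) * V (x₁, p₀.2)) = _
      ring
    rw [e] at p3
    exact pos_of_mul_pos_left p3 (sq_nonneg _)
  set x₁ := p₀.1 + r / 2 with hx₁
  set x₂ := p₀.1 - r / 2 with hx₂
  have hx₁r : |x₁ - p₀.1| < r := by
    rw [hx₁, abs_lt]; constructor <;> linarith
  have hx₂r : |x₂ - p₀.1| < r := by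
    rw [hx₂, abs_lt]; constructor <;> linarith
  have hright : ∀ y, |y - p₀.2| < r₂ → ∀ t, |t - p₀.1| < r → ∀ t', |t' - p₀.1| < r → t < t' →
      0 ≤ g (t, y) → 0 < g (t', y) := fun y hy t ht t' ht' hlt h0 =>
    h0.trans_lt (hmono ht ht' (hy.trans hr₂r) hlt)
  have hleft : ∀ y, |y - p₀.2| < r₂ → ∀ t, |t - p₀.1| < r → ∀ t', |t' - p₀.1| < r → t' < t →
      g (t, y) ≤ 0 → g (t', y) < 0 := fun y hy t ht t' ht' hlt h0 =>
    (hmono ht' ht (hy.trans hr₂r) hlt).trans_le h0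
  have hx₁pos : ∀ y, |y - p₀.2| < r₂ → 0 < g (x₁, y) := by
    intro y hy
    obtain ⟨ξ, hξ, hξZ⟩ := hslice y hy
    have h := abs_lt.1 hξ
    exact hright y hy ξ (by rw [abs_lt]; constructor <;> linarith) x₁ hx₁r (by linarith)
      (hZ.g_eq_zero _ hξZ).ge
  have hx₂neg : ∀ y, |y - p₀.2| < r₂ → g (x₂, y) < 0 := by
    intro y hy
    obtain ⟨ξ, hξ, hξZ⟩ := hslice y hy
    have h := abs_lt.1 hξ
    exact hleft y hy ξ (by rw [abs_lt]; constructor <;> linarith) x₂ hx₂r (by linarith)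
      (hZ.g_eq_zero _ hξZ).le
  have hpos : ∀ z ∈ Metric.ball p₀ r₂, 0 < g z → 0 < V z * V (x₁, p₀.2) := by
    intro z hz hgz
    obtain ⟨hz1, hz2⟩ := mem_ball_prod.1 hz
    have hz1' := hz1.trans hr₂r
    refine hmove x₁ hx₁r z hz (fun t ht => ?_) fun y hy => (hx₁pos y hy).ne'
    have htr : |t - p₀.1| < r := by
      rw [abs_lt] at hx₁r hz1' ⊢
      rw [mem_uIcc] at ht
      constructor <;> rcases ht with ht | ht <;> linarith [ht.1, ht.2]
    rw [mem_uIcc] at ht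
    rcases ht with ht | ht
    · rcases ht.1.eq_or_lt with h | h
      · rw [← h]; exact hgz.ne'
      · exact (hright z.2 hz2 z.1 hz1' t htr h hgz.le).ne'
    · rcases ht.1.eq_or_lt with h | h
      · rw [← h]; exact (hx₁pos _ hz2).ne'
      · exact (hright z.2 hz2 x₁ hx₁r t htr h (hx₁pos _ hz2).le).ne'
  have hneg : ∀ z ∈ Metric.ball p₀ r₂, g z < 0 → 0 < V z * V (x₂, p₀.2) := by
    intro z hz hgz
    obtain ⟨hz1, hz2⟩ := mem_ball_prod.1 hz
    have hz1' := hz1.trans hr₂r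
    refine hmove x₂ hx₂r z hz (fun t ht => ?_) fun y hy => (hx₂neg y hy).ne
    have htr : |t - p₀.1| < r := by
      rw [abs_lt] at hx₂r hz1' ⊢
      rw [mem_uIcc] at ht
      constructor <;> rcases ht with ht | ht <;> linarith [ht.1, ht.2]
    rw [mem_uIcc] at ht
    rcases ht with ht | ht
    · rcases ht.2.eq_or_lt with h | h
      · rw [h]; exact (hx₂neg _ hz2).ne
      · exact (hleft z.2 hz2 x₂ hx₂r t htr h (hx₂neg _ hz2).le).ne
    · rcases ht.2.eq_or_lt with h | h
      · rw [h]; exact hgz.ne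
      · exact (hleft z.2 hz2 z.1 hz1' t htr h hgz.le).ne
  -- The horizontal line through `z` contains a point of `Γ`, and `g` has only one zero on that
  -- line, so `z` lies on `Γ`.
  have hzero : ∀ z ∈ Metric.ball p₀ r₂, g z = 0 → V z = 0 := by
    intro z hz hgz
    obtain ⟨hz1, hz2⟩ := mem_ball_prod.1 hz
    have hz1' := hz1.trans hr₂r
    obtain ⟨ξ, hξ, hξZ⟩ := hslice z.2 hz2
    have hξr : |ξ - p₀.1| < r := by linarith
    have hξ0 := hZ.g_eq_zero _ hξZ
    have he : z = (ξ, z.2) := by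
      refine Prod.ext ?_ rfl
      by_contra hne
      rcases lt_or_gt_of_ne hne with h | h
      · have := hright z.2 hz2 z.1 hz1' ξ hξr h hgz.ge
        linarith
      · have := hright z.2 hz2 ξ hξr z.1 hz1' h hξ0.ge
        change 0 < g z at this
        linarith
    have hmemT := (hr z (Metric.ball_subset_ball hr₂r.le hz)).1
    exact (hψ _ hmemT.2).1.1 (by rw [he]; exact hξZ.2)
  -- both signs of `V` occur near `p₀`
  have hq2 : (ψ q).2 = 0 := (hψ q hqψ).1.1 hΓ
  have hvals : ∀ᶠ t in 𝓝 (0 : ℝ), ∃ z ∈ Metric.ball p₀ r₂, V z = t := by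
    set ℓ : ℝ → ℝ × ℝ := fun t => ((ψ q).1, t) with hℓ
    have hℓc : Continuous ℓ := by fun_prop
    have hℓ0 : ℓ 0 = ψ q := Prod.ext rfl hq2.symm
    have hψt : ψ q ∈ ψ.target := ψ.map_source hqψ
    have c1 : Tendsto (fun t => ψ.symm (ℓ t)) (𝓝 0) (𝓝 q) := by
      have h1 : Tendsto ψ.symm (𝓝 (ψ q)) (𝓝 q) := by
        simpa [ψ.left_inv hqψ] using (ψ.symm.continuousAt hψt).tendsto
      exact h1.comp (by simpa [hℓ0] using hℓc.tendsto 0)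
    have hqφ : q ∈ φ.source := φ.map_target hp₀
    have hφq : φ q = p₀ := φ.right_inv hp₀
    have c2 : Tendsto (fun t => φ (ψ.symm (ℓ t))) (𝓝 0) (𝓝 p₀) := by
      have h1 : Tendsto φ (𝓝 q) (𝓝 p₀) := by
        simpa [hφq] using (φ.continuousAt hqφ).tendsto
      exact h1.comp c1
    have e3 : ∀ᶠ t in 𝓝 (0 : ℝ), ℓ t ∈ ψ.target :=
      hℓc.continuousAt.eventually_mem (by rw [hℓ0]; exact ψ.open_target.mem_nhds hψt)
    filter_upwards [c2.eventually (Metric.ball_mem_nhds p₀ hr₂0),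
      c1.eventually (φ.open_source.mem_nhds hqφ), e3] with t h1 h2 h3
    refine ⟨_, h1, ?_⟩
    simp only [hV]
    rw [φ.left_inv h2, ψ.right_inv h3]
  obtain ⟨η, hη, hηv⟩ := Metric.eventually_nhds_iff.1 hvals
  have hsign : ∀ σ : ℝ, σ ≠ 0 → ∃ z ∈ Metric.ball p₀ r₂, V z * σ < 0 := by
    intro σ hσ
    rcases lt_or_gt_of_ne hσ with h | h
    · obtain ⟨z, hz, he⟩ := hηv (y := η / 2) (by
        rw [Real.dist_eq, sub_zero, abs_of_pos (by positivity)]; linarith)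
      exact ⟨z, hz, by rw [he]; nlinarith⟩
    · obtain ⟨z, hz, he⟩ := hηv (y := -(η / 2)) (by
        rw [Real.dist_eq, sub_zero, abs_neg, abs_of_pos (by positivity)]; linarith)
      exact ⟨z, hz, by rw [he]; nlinarith⟩
  have hy0 : |p₀.2 - p₀.2| < r₂ := by simpa using hr₂0
  have hV1 : V (x₁, p₀.2) ≠ 0 := fun h => (hx₁pos _ hy0).ne'
    (hV0 _ (hr (x₁, p₀.2) (mem_ball_prod.2 ⟨hx₁r, hy0.trans hr₂r⟩)).1 h)
  -- A point where `V` has the sign opposite to `V (x₁, p₀.2)` cannot have `g ≥ 0`; hence `g < 0`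
  -- there, and `V (x₂, p₀.2)` shares its sign.
  have hopp : V (x₁, p₀.2) * V (x₂, p₀.2) < 0 := by
    obtain ⟨z, hz, hlt⟩ := hsign _ hV1
    have hgz : g z < 0 := by
      rcases lt_trichotomy (g z) 0 with h | h | h
      · exact h
      · rw [hzero z hz h] at hlt; simp at hlt
      · linarith [hpos z hz h]
    have := mul_neg_of_neg_of_pos hlt (hneg z hz hgz)
    have e : V z * V (x₁, p₀.2) * (V z * V (x₂, p₀.2))
      = (V (x₁, p₀.2) * V (x₂, p₀.2)) * V z ^ 2 := by ring
    rw [e] at this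
    by_contra hcon
    have := mul_nonneg (not_lt.1 hcon) (sq_nonneg (V z))
    linarith
  have hSS : ∀ z ∈ Metric.ball p₀ r₂, (φ.symm z ∈ S ↔ 0 < V z) ∧ (φ.symm z ∈ S' ↔ V z < 0) :=
    fun z hz => (hψ _ (hr z (Metric.ball_subset_ball hr₂r.le hz)).1.2).2
  rcases lt_or_gt_of_ne hV1 with hV1 | hV1
  · refine ⟨-1, by norm_num, ?_⟩
    have hV2 : 0 < V (x₂, p₀.2) := by nlinarith
    filter_upwards [Metric.ball_mem_nhds p₀ hr₂0] with z hz
    rw [(hSS z hz).1, (hSS z hz).2]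
    constructor
    · intro h
      exact pos_of_mul_pos_left (hneg z hz (by linarith)) hV2.le
    · intro h
      rcases lt_trichotomy (g z) 0 with h1 | h1 | h1
      · have := hneg z hz h1
        nlinarith
      · linarith [hzero z hz h1]
      · linarith
  · refine ⟨1, by norm_num, ?_⟩
    have hV2 : V (x₂, p₀.2) < 0 := by nlinarith
    filter_upwards [Metric.ball_mem_nhds p₀ hr₂0] with z hz
    rw [(hSS z hz).1, (hSS z hz).2]
    constructor
    · intro h
      exact pos_of_mul_pos_left (hpos z hz (by linarith)) hV1.le
    · intro h
      rcases lt_trichotomy (g z) 0 with h1 | h1 | h1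
      · linarith
      · linarith [hzero z hz h1]
      · have := hpos z hz h1
        nlinarith

end Crossing

/-! ### Crossing the singular curve -/

section Main

variable {M : Type*} [TopologicalSpace M] [ChartedSpace (ℝ × ℝ) M]
  [IsManifold 𝓘(ℝ, ℝ × ℝ) ∞ M] {X : M → H1} {Γ S S' : Set M}

/-- Near `q₀` the function `ω` has the sign of `Q ≠ 0` on both sides, while `ε g` is negative on
`S'`. The type of `S` determines the sign of `Q ε`, and so the sign of `ω g` on `S'`; the bound by
`1` comes from `ω → Q` and `g → 0`. -/
theorem exists_crossing_chart (hX : IsImmersedSurface X) (hmin : IsPMinimal X)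
    (hsing : ∀ q ∈ Γ, IsSingularPoint X q) (hsides : IsCurveWithSides Γ S S')
    (hS : IsTypeII X S ∨ IsTypeIII X S) {q₀ : M} (hq₀ : q₀ ∈ Γ) :
    ∃ (φ : OpenPartialHomeomorph M (ℝ × ℝ)) (c s : ℝ) (u : ℝ × ℝ → ℝ) (W : Set M),
      IsGraphChart X φ c s u ∧ IsOpen W ∧ q₀ ∈ W ∧ W ⊆ φ.source ∧ IsOpen (W ∩ S') ∧
      ∀ q ∈ W ∩ S', formG u (φ q) ≠ 0 ∧
        |spread (formK u) (formG u) (φ q) * formG u (φ q)| < 1 ∧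
        (IsTypeII X S → 0 < spread (formK u) (formG u) (φ q) * formG u (φ q)) ∧
        (IsTypeIII X S → spread (formK u) (formG u) (φ q) * formG u (φ q) < 0) := by
  obtain ⟨φ, c, s, u, hφ, hqφ, hpos⟩ := exists_graphChart hX (hsing q₀ hq₀)
  have H := hφ.isPMinimalForm hX hmin
  set k := formK u
  set g := formG u
  set p₀ := φ q₀
  have hpt : p₀ ∈ φ.target := φ.map_source hqφ
  have hps : φ.symm p₀ = q₀ := φ.left_inv hqφ
  have hZ : IsSingularCurveAt (chartImage φ Γ) k g p₀ :=
    hφ.isSingularCurveAt hX hsing hsides ⟨hpt, by rwa [hps]⟩ hpos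
  obtain ⟨ε, hε, hside⟩ := hZ.exists_sign hsides (fun p hp => H.smooth_g p hp)
  obtain ⟨Q, hQ⟩ := H.exists_tendsto_spread hpt hZ
  have hII : IsTypeII X S → ∀ᶠ z in 𝓝 p₀, 0 < ε * g z → spread k g z * g z < 0 := by
    intro hS
    filter_upwards [hside, φ.open_target.mem_nhds hpt] with z hz hzt hgz
    have := hφ.invariant_pos_of_typeII hX H hS (hz.1 hgz) (φ.map_target hzt)
    rw [φ.right_inv hzt] at this
    exact this (right_ne_zero_of_mul hgz.ne')
  have hIII : IsTypeIII X S → ∀ᶠ z in 𝓝 p₀, 0 < ε * g z → 0 < spread k g z * g z := by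
    intro hS
    filter_upwards [hside, φ.open_target.mem_nhds hpt] with z hz hzt hgz
    have := hφ.invariant_neg_of_typeIII hX H hS (hz.1 hgz) (φ.map_target hzt)
    rw [φ.right_inv hzt] at this
    exact this (right_ne_zero_of_mul hgz.ne')
  have hQ0 : Q ≠ 0 := by
    refine H.spread_limit_ne_zero hpt hZ hε ?_ hQ
    rcases hS with hS | hS
    · filter_upwards [hII hS] with z hz hgz using left_ne_zero_of_mul (hz hgz).ne
    · filter_upwards [hIII hS] with z hz hgz using left_ne_zero_of_mul (hz hgz).ne'
  have hsame : ∀ᶠ z in 𝓝 p₀, g z ≠ 0 → 0 < spread k g z * Q :=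
    eventually_nhdsWithin_iff.1 ((hQ.mul_const Q).eventually_const_lt (mul_self_pos.2 hQ0))
  have hsmall : ∀ᶠ z in 𝓝 p₀, g z ≠ 0 → |spread k g z * g z| < 1 := by
    have hg : Tendsto g (𝓝[{q | g q ≠ 0}] p₀) (𝓝 0) := by
      have := (H.smooth_g _ hpt).continuousAt.tendsto
      rw [hZ.g_eq_zero _ hZ.mem] at this
      exact this.mono_left nhdsWithin_le_nhds
    have := (hQ.mul hg).abs
    rw [mul_zero, abs_zero] at this
    exact eventually_nhdsWithin_iff.1 (this.eventually_lt_const one_pos)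
  have hfreq : ∃ᶠ z in 𝓝 p₀, 0 < ε * g z := fun hcon => by
    have h1 := H.eventually_pos_ray hpt hZ hε
    obtain ⟨t, h2, h3⟩ := (((tendsto_ray p₀ _).eventually hcon).and h1).exists
    exact h2 h3
  -- Bookkeeping of signs: `ω g` has the sign of the product of `ω Q`, `Q ε` and `ε g`.
  have hfactor : ∀ z, (spread k g z * Q) * (Q * ε) * (ε * g z) * ε ^ 2
      = (spread k g z * g z) * Q ^ 2 * (ε ^ 2 * ε ^ 2) := fun z => by ring
  have hQ2 : 0 < Q ^ 2 := by positivity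
  have hQII : IsTypeII X S → Q * ε < 0 := by
    intro hS
    obtain ⟨z, hz, h1, h2⟩ := (hfreq.and_eventually ((hII hS).and hsame)).exists
    have a1 := h1 hz
    have a2 := h2 (right_ne_zero_of_mul hz.ne')
    have e := hfactor z
    rw [hε] at e
    by_contra hcon
    have := mul_nonneg (mul_nonneg a2.le (not_lt.1 hcon)) hz.le
    nlinarith
  have hQIII : IsTypeIII X S → 0 < Q * ε := by
    intro hS
    obtain ⟨z, hz, h1, h2⟩ := (hfreq.and_eventually ((hIII hS).and hsame)).exists
    have a1 := h1 hz
    have a2 := h2 (right_ne_zero_of_mul hz.ne')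
    have e := hfactor z
    rw [hε] at e
    by_contra hcon
    have := mul_nonneg (mul_nonneg a2.le (neg_nonneg.2 (not_lt.1 hcon))) hz.le
    nlinarith
  obtain ⟨A, hA, hAo, hpA⟩ := eventually_nhds_iff.1 (hside.and (hsame.and hsmall))
  -- `S'` is described only near `Γ` and need not be open; intersecting with the domain of `ψ` makes
  -- `W ∩ S'` open.
  obtain ⟨ψ, hqψ, hψ⟩ := hsides q₀ hq₀
  refine ⟨φ, c, s, u, ψ.source ∩ (φ.source ∩ φ ⁻¹' A), hφ,
    ψ.open_source.inter (φ.isOpen_inter_preimage hAo), ⟨hqψ, hqφ, hpA⟩,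
    fun x hx => hx.2.1, ?_, ?_⟩
  · have : ψ.source ∩ (φ.source ∩ φ ⁻¹' A) ∩ S'
        = (φ.source ∩ φ ⁻¹' A) ∩ (ψ.source ∩ ψ ⁻¹' {p | p.2 < 0}) := by
      ext x
      constructor
      · rintro ⟨⟨h1, h2⟩, h3⟩
        exact ⟨h2, h1, (hψ x h1).2.2.1 h3⟩
      · rintro ⟨h2, h1, h3⟩
        exact ⟨⟨h1, h2⟩, (hψ x h1).2.2.2 h3⟩
    rw [this]
    exact (φ.isOpen_inter_preimage hAo).inter
      (ψ.isOpen_inter_preimage (isOpen_lt continuous_snd continuous_const))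
  · rintro q ⟨⟨-, hqs, hqA⟩, hqS'⟩
    obtain ⟨b1, b2, b3⟩ := hA _ hqA
    rw [φ.left_inv hqs] at b1
    have hneg := b1.2 hqS'
    have hg0 : g (φ q) ≠ 0 := right_ne_zero_of_mul hneg.ne
    have e := hfactor (φ q)
    rw [hε] at e
    refine ⟨hg0, b3 hg0, fun hS => ?_, fun hS => ?_⟩
    · have := mul_pos_of_neg_of_neg (mul_neg_of_pos_of_neg (b2 hg0) (hQII hS)) hneg
      by_contra hcon
      nlinarith
    · have := mul_neg_of_pos_of_neg (mul_pos (b2 hg0) (hQIII hS)) hneg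
      by_contra hcon
      nlinarith

end Main

end

end HeisenbergSurface

/-- `X : M → H₁` is a smooth `p`-minimal surface and `Γ` a curve of singular points in it, with the
part `S` on one side and `S'` on the other. So `M` is a smooth extension of `S` through the singular
curve `Γ`. -/
theorem theorem1p10 {M : Type*} [TopologicalSpace M] [ChartedSpace (ℝ × ℝ) M]
    [IsManifold 𝓘(ℝ, ℝ × ℝ) ∞ M] (X : M → HeisenbergSurface.H1)
    (hX : HeisenbergSurface.IsImmersedSurface X)
    (hmin : HeisenbergSurface.IsPMinimal X)
    (Γ S S' : Set M)
    (hsing : ∀ q ∈ Γ, HeisenbergSurface.IsSingularPoint X q)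
    (hsides : HeisenbergSurface.IsCurveWithSides Γ S S') :
    (HeisenbergSurface.IsTypeII X S →
      ∃ V : Set M, IsOpen V ∧ Γ ⊆ V ∧ HeisenbergSurface.IsTypeIII X (V ∩ S')) ∧
    (HeisenbergSurface.IsTypeIII X S →
      ∃ V : Set M, IsOpen V ∧ Γ ⊆ V ∧ HeisenbergSurface.IsTypeII X (V ∩ S')) := by
  constructor
  · intro hS
    choose φ c s u W hφ hWo hqW hWs hWS hW using fun q : Γ =>
      HeisenbergSurface.exists_crossing_chart hX hmin hsing hsides (Or.inl hS) q.2
    refine ⟨⋃ q, W q, isOpen_iUnion hWo, fun q hq => Set.mem_iUnion.2 ⟨⟨q, hq⟩, hqW _⟩, ?_⟩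
    rintro q ⟨hq, hqS⟩
    obtain ⟨i, hi⟩ := Set.mem_iUnion.1 hq
    obtain ⟨h0, -, h2, -⟩ := hW i q ⟨hi, hqS⟩
    obtain ⟨ψ, c₁, c₂, hqψ, hsub, h⟩ := (hφ i).exists_typeIII_chart hX
      ((hφ i).isPMinimalForm hX hmin) (hWs i hi) (hWS i) ⟨hi, hqS⟩ h0 (h2 hS)
    exact ⟨ψ, c₁, c₂, hqψ,
      hsub.trans (Set.inter_subset_inter_left _ (Set.subset_iUnion W i)), h⟩
  · intro hS
    choose φ c s u W hφ hWo hqW hWs hWS hW using fun q : Γ =>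
      HeisenbergSurface.exists_crossing_chart hX hmin hsing hsides (Or.inr hS) q.2
    refine ⟨⋃ q, W q, isOpen_iUnion hWo, fun q hq => Set.mem_iUnion.2 ⟨⟨q, hq⟩, hqW _⟩, ?_⟩
    rintro q ⟨hq, hqS⟩
    obtain ⟨i, hi⟩ := Set.mem_iUnion.1 hq
    obtain ⟨h0, h1, -, h2⟩ := hW i q ⟨hi, hqS⟩
    -- Here the smallness of `ω g` matters: `c₂ = w² (-1 - ω g) < 0` needs `ω g > -1`, which is
    -- automatic when `ω g > 0`.
    obtain ⟨ψ, c₁, c₂, hqψ, hsub, h⟩ := (hφ i).exists_typeII_chart hX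
      ((hφ i).isPMinimalForm hX hmin) (hWs i hi) (hWS i) ⟨hi, hqS⟩ h0 (abs_lt.1 h1).1 (h2 hS)
    exact ⟨ψ, c₁, c₂, hqψ,
      hsub.trans (Set.inter_subset_inter_left _ (Set.subset_iUnion W i)), h⟩
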